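/- Corollary 2.4. For a semigroup $S$ and $r\ge 1$ let $S^r=\{s_1s_2\cdots s_r : s_1,\dots,s_r\in S\}$; $S$ is nilpotent of degree $r$ if $r$ is the least positive integer with $|S^r|=1$. A semigroup is self-dual if it is isomorphic to its dual, i.e. to the semigroup on the same set with multiplication $x\ast y=y\cdot x$. For a partition $j$ of a non-negative integer (written $j\vdash n$) let $j_i$ be the number of summands of $j$ equal to $i$. For integers $1\le q<p$ put $$N(p,q)=\sum_{j\vdash q-1}\ \sum_{k\vdash p-q}\Bigl(\prod_{i=1}^{q-1}j_i!\,i^{j_i}\prod_{i=1}^{p-q}k_i!\,i^{k_i}\Bigr)^{-1}\prod_{a,b=1}^{p-q}\Bigl(1+\sum_{d\mid \operatorname{lcm}(a,b)}d\,j_d\Bigr)^{k_ak_b\gcd(a,b)}$$ and $$L(p,q)=\tfrac12 N(p,q)+\tfrac12\sum_{j\vdash q-1}\ \sum_{k\vdash p-q}\Bigl(\prod_{i=1}^{q-1}j_i!\,i^{j_i}\prod_{i=1}^{p-q}k_i!\,i^{k_i}\Bigr)^{-1}\prod_{a=1}^{p-q}\Bigl(q_a^{k_a}\,p_{a,a}^{k_a^2-k_a}\prod_{b=1}^{a-1}p_{a,b}^{2k_ak_b}\Bigr),$$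 where, for each $j$, $$p_{a,b}=\Bigl(1+\sum_{d\mid \operatorname{lcm}(2,a,b)}d\,j_d\Bigr)^{ab/\operatorname{lcm}(2,a,b)}$$ and $$q_a=\begin{cases}\bigl(1+\sum_{d\mid a}d\,j_d\bigr)\bigl(1+\sum_{d\mid 2a}d\,j_d\bigr)^{(a-1)/2}&\text{if } a\equiv 1 \bmod 2,\\ \bigl(1+\sum_{d\mid a}d\,j_d\bigr)^{a}&\text{if } a\equiv 0 \bmod 4,\\ \bigl(1+\sum_{d\mid a/2}d\,j_d\bigr)^{2}\bigl(1+\sum_{d\mid a}d\,j_d\bigr)^{a-1}&\text{if } a\equiv 2 \bmod 4.\end{cases}$$ Then for every integer $n\ge 1$ the number of self-dual nilpotent semigroups of degree $3$ and order $n$, up to isomorphism, equals $$\sum_{m=2}^{a(n)}\bigl(2L(n,m)-N(n,m)-2L(n-1,m-1)+N(n-1,m-1)\bigr),\qquad a(n)=\Bigl\lfloor n+\tfrac12-\sqrt{n-\tfrac34}\,\Bigr\rfloor .$$ -/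

import Mathlib

noncomputable section

namespace Nilpotent3

/-! ### Semigroups -/

/-- The set `S^r = {s₁ s₂ ⋯ s_r | s₁, …, s_r ∈ S}` of all `r`-fold products of elements of `S`,
for `r ≥ 1` (it is empty for `r = 0`). -/
def productSet (S : Type*) [Semigroup S] (r : ℕ) : Set S :=
  {x | ∃ (s : S) (l : List S), l.length + 1 = r ∧ x = l.foldl (fun y z => y * z) s}

/-- `S` is nilpotent of degree `r`: `r` is the least positive integer such that `S^r` has
exactly one element. -/
def HasNilpotencyDegree (S : Type*) [Semigroup S] (r : ℕ) : Prop :=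
  IsLeast {k : ℕ | 1 ≤ k ∧ (productSet S k).encard = 1} r

/-- `S` is self-dual: it is isomorphic to its dual (the opposite semigroup). -/
def IsSelfDual (S : Type*) [Semigroup S] : Prop :=
  Nonempty (S ≃* Sᵐᵒᵖ)

/-- Isomorphism, as an equivalence relation on the set of all semigroup structures on an
`n`-element set. The multiplications are passed explicitly, so that the arithmetic
multiplication of `Fin n` plays no role. -/
def isoSetoid (n : ℕ) : Setoid (Semigroup (Fin n)) where
  r S T := Nonempty (@MulEquiv (Fin n) (Fin n) S.toMul T.toMul)
  iseqv :=
    { refl := fun S => ⟨@MulEquiv.refl (Fin n) S.toMul⟩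
      symm := fun {S T} ⟨e⟩ => ⟨@MulEquiv.symm (Fin n) (Fin n) S.toMul T.toMul e⟩
      trans := fun {S T U} ⟨e⟩ ⟨f⟩ =>
        ⟨@MulEquiv.trans (Fin n) (Fin n) (Fin n) S.toMul T.toMul U.toMul e f⟩ }

/-- The number, up to isomorphism, of semigroups of order `n` with the property `P`. -/
def numUpToIso (n : ℕ) (P : Semigroup (Fin n) → Prop) : ℕ :=
  Nat.card (Quotient ((isoSetoid n).comap (Subtype.val : {S // P S} → Semigroup (Fin n))))

/-- The number of self-dual nilpotent semigroups of degree `3` and order `n`, up to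
isomorphism. -/
def numSelfDualNilpotent3 (n : ℕ) : ℕ :=
  numUpToIso n fun S => @HasNilpotencyDegree (Fin n) S 3 ∧ @IsSelfDual (Fin n) S

/-! ### The formulae -/

/-- For a partition `j`, the number `j_i` of summands equal to `i`. -/
def mult {n : ℕ} (j : n.Partition) (i : ℕ) : ℕ := j.parts.count i

/-- `∏_{i=1}^n j_i! i^{j_i}` for a partition `j` of `n`. -/
def centralizerOrder {n : ℕ} (j : n.Partition) : ℝ :=
  ∏ i ∈ Finset.Icc 1 n, ((mult j i).factorial : ℝ) * (i : ℝ) ^ mult j i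

/-- `1 + ∑_{d ∣ e} d j_d`. -/
def cycleSum {n : ℕ} (j : n.Partition) (e : ℕ) : ℝ :=
  1 + ∑ d ∈ e.divisors, (d : ℝ) * (mult j d : ℝ)

/-- `N(p,q)`, meaningful for `1 ≤ q < p`. -/
def N (p q : ℕ) : ℝ :=
  ∑ j : (q - 1).Partition, ∑ k : (p - q).Partition,
    (centralizerOrder j * centralizerOrder k)⁻¹ *
      ∏ a ∈ Finset.Icc 1 (p - q), ∏ b ∈ Finset.Icc 1 (p - q),
        cycleSum j (Nat.lcm a b) ^ (mult k a * mult k b * Nat.gcd a b)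

/-- `p_{a,b} = (1 + ∑_{d ∣ lcm(2,a,b)} d j_d)^{ab / lcm(2,a,b)}`. The exponent is a half-integer
when `a` and `b` are odd, so this is a real power (of a real number that is at least `1`). -/
def pFactor {n : ℕ} (j : n.Partition) (a b : ℕ) : ℝ :=
  cycleSum j (Nat.lcm 2 (Nat.lcm a b)) ^
    (((a : ℝ) * (b : ℝ)) / (Nat.lcm 2 (Nat.lcm a b) : ℝ))

/-- The factor `q_a`, by the residue of `a` modulo `4`. -/
def qFactor {n : ℕ} (j : n.Partition) (a : ℕ) : ℝ :=
  if a % 2 = 1 then cycleSum j a * cycleSum j (2 * a) ^ ((a - 1) / 2)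
  else if a % 4 = 0 then cycleSum j a ^ a
  else cycleSum j (a / 2) ^ 2 * cycleSum j a ^ (a - 1)

/-- `L(p,q)`, meaningful for `1 ≤ q < p`. -/
def L (p q : ℕ) : ℝ :=
  1 / 2 * N p q + 1 / 2 *
    ∑ j : (q - 1).Partition, ∑ k : (p - q).Partition,
      (centralizerOrder j * centralizerOrder k)⁻¹ *
        ∏ a ∈ Finset.Icc 1 (p - q),
          (qFactor j a ^ mult k a * pFactor j a a ^ (mult k a ^ 2 - mult k a) *
            ∏ b ∈ Finset.Icc 1 (a - 1), pFactor j a b ^ (2 * mult k a * mult k b))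

/-- `a(n) = ⌊n + 1/2 - √(n - 3/4)⌋`. -/
def upperIndex (n : ℕ) : ℕ :=
  ⌊(n : ℝ) + 1 / 2 - √((n : ℝ) - 3 / 4)⌋₊

end Nilpotent3

end

/-! Let S be nilpotent of degree 3 with zero 0, and put m = |S²|, A = S \ S², C = S² \ {0}. A
product with a factor in S² is a triple product, hence 0, so S amounts to a table A × A → C ∪ {0} in
which every element of C occurs. Conversely every such table with C nonempty gives such a semigroup,
associativity being automatic. Isomorphisms become renamings by Sym(A) × Sym(C), and dualising
becomes transposition (`numClasses_semigroup_eq`).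

Self-dual tables form the orbits that transposition τ sends to themselves. As τ commutes with the
group, Burnside's lemma on the union of these orbits shows that their number is the average over g
of the number of tables f with g • τ f = f (`numClasses_mul_card`). For g = (σ, π) this condition is
equivariance between (x, y) ↦ (σ y, σ x) on A × A and π on C ∪ {0}. A cycle of length e on pairs
therefore contributes the number of fixed points of π^e, which is 1 + ∑_{d ∣ e} d j_d
(`card_equivariant`, `numFixed_optionCongr_pow`). Elements in different cycles of σ, of lengths a
and b, form pairs in cycles of length lcm(2, a, b), giving p_{a,b}; pairs inside one cycle of length
a give q_a (`prod_minimalPeriod_twist`). Grouping (σ, π) by cycle type gives exactly 2L − N.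

Tables that miss an element of C are, up to renaming, tables with C smaller by one, so requiring all
of C to occur turns the count into a difference (`numClasses_isFull`). All of C can occur only if m
− 1 ≤ (n − m)², which fails for m beyond a(n). -/

noncomputable section

namespace Nilpotent3

/-! ### Counting equivalence classes -/

/-- The number of classes of elements with property `P`. -/
def numClasses {X : Type*} (s : Setoid X) (P : X → Prop) : ℕ :=
  Nat.card (Quotient (s.comap (Subtype.val : {x // P x} → X)))

theorem numClasses_congr_of_map {X Y : Type*} {s : Setoid X} {t : Setoid Y}
    {P : X → Prop} {Q : Y → Prop} (F : X → Y) (hPQ : ∀ x, P x → Q (F x))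
    (hrel : ∀ x x', P x → P x' → (s x x' ↔ t (F x) (F x')))
    (hsurj : ∀ y, Q y → ∃ x, P x ∧ t (F x) y) : numClasses s P = numClasses t Q := by
  refine Nat.card_eq_of_bijective
    (Quotient.map (fun x : {x // P x} => (⟨F x.1, hPQ _ x.2⟩ : {y // Q y})) ?_) ⟨?_, ?_⟩
  · intro x x' h
    exact (hrel _ _ x.2 x'.2).1 h
  · rintro ⟨x⟩ ⟨x'⟩ h
    exact Quotient.sound ((hrel _ _ x.2 x'.2).2
      (Quotient.exact (s := t.comap (Subtype.val : {y // Q y} → Y)) h))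
  · rintro ⟨y⟩
    obtain ⟨x, hx, h⟩ := hsurj y.1 y.2
    exact ⟨Quotient.mk _ ⟨x, hx⟩, Quotient.sound h⟩

theorem numClasses_eq_zero {X : Type*} {s : Setoid X} {P : X → Prop} (h : ∀ x, ¬ P x) :
    numClasses s P = 0 := by
  have : IsEmpty (Quotient (s.comap (Subtype.val : {x // P x} → X))) :=
    ⟨fun q => q.inductionOn fun x => h _ x.2⟩
  exact Nat.card_of_isEmpty

theorem numClasses_eq_sum {X ι : Type*} [Finite X] (s : Setoid X) (P : X → Prop) (φ : X → ι)
    (I : Finset ι) (hφ : ∀ x y, s x y → φ x = φ y) (hI : ∀ x, P x → φ x ∈ I) :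
    numClasses s P = ∑ i ∈ I, numClasses s (fun x => P x ∧ φ x = i) := by
  classical
  have e : Quotient (s.comap (Subtype.val : {x // P x} → X)) ≃
      Σ i : I, Quotient (s.comap (Subtype.val : {x // P x ∧ φ x = i} → X)) := by
    refine (Equiv.ofBijective (fun z : Σ i : I,
      Quotient (s.comap (Subtype.val : {x // P x ∧ φ x = i} → X)) =>
        Quotient.map' (s₂ := s.comap (Subtype.val : {x // P x} → X))
          (fun x => ⟨x.1, x.2.1⟩) (fun _ _ h => h) z.2) ⟨?_, ?_⟩).symm
    · rintro ⟨i, ⟨x⟩⟩ ⟨i', ⟨x'⟩⟩ h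
      have h' : s x.1 x'.1 := Quotient.exact (s := s.comap (Subtype.val : {x // P x} → X)) h
      have hi : i = i' := Subtype.ext (by rw [← x.2.2, ← x'.2.2]; exact hφ _ _ h')
      subst hi
      congr 1
      exact Quotient.sound h'
    · rintro ⟨x⟩
      exact ⟨⟨⟨φ x.1, hI _ x.2⟩, Quotient.mk _ ⟨x.1, x.2, rfl⟩⟩, rfl⟩
  rw [numClasses, Nat.card_congr e, Nat.card_sigma, ← Finset.sum_coe_sort I]
  rfl

theorem numClasses_eq_add {X : Type*} [Finite X] (s : Setoid X) (P Q : X → Prop)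
    (hQ : ∀ x y, s x y → (Q x ↔ Q y)) :
    numClasses s P = numClasses s (fun x => P x ∧ Q x) + numClasses s (fun x => P x ∧ ¬ Q x) := by
  rw [numClasses_eq_sum s P Q {True, False} (fun x y h => propext (hQ x y h))
    (fun x _ => by by_cases h : Q x <;> simp [h]), Finset.sum_pair (by simp)]
  simp

/-! ### A twisted form of Burnside's lemma -/

/-- The elements `g` form a translate of the stabilizer: `g • h • x = x` says that `g * h` lies in
it. -/
theorem card_eq_card_stabilizer {G X : Type*} [Group G] [MulAction G X] {x y : X} {h : G}
    (hy : y = h • x) : Nat.card {g : G // g • y = x} = Nat.card (MulAction.stabilizer G x) := by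
  refine Nat.card_congr ((Equiv.mulRight h).subtypeEquiv fun g => ?_)
  subst hy
  simp [MulAction.mem_stabilizer_iff, mul_smul]

/-- The orbits that a map `τ` commuting with the action sends to themselves, times the order of
the group, are counted by the pairs `(g, x)` such that `g • τ x = x`. -/
theorem numClasses_mul_card {G X : Type*} [Group G] [Finite G] [Finite X] [MulAction G X]
    (τ : X → X) (hτ : ∀ (g : G) x, τ (g • x) = g • τ x) :
    numClasses (MulAction.orbitRel G X) (fun x => MulAction.orbitRel G X (τ x) x) * Nat.card G =
      ∑ᶠ g : G, Nat.card {x : X // g • τ x = x} := by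
  classical
  cases nonempty_fintype G
  cases nonempty_fintype X
  -- The union of the `τ`-stable orbits is invariant, so the ordinary Burnside lemma applies to it;
  -- it remains to compare two sets of pairs by summing over points.
  let Y : SubMulAction G X :=
    { carrier := {x | MulAction.orbitRel G X (τ x) x}
      smul_mem' := by
        rintro g x ⟨h, hx⟩
        refine ⟨g * h * g⁻¹, ?_⟩
        simp only at hx
        simp [hτ, mul_smul, hx] }
  have hcls : numClasses (MulAction.orbitRel G X) (fun x => MulAction.orbitRel G X (τ x) x) =
      Fintype.card (MulAction.orbitRel.Quotient G Y) := by
    rw [← Nat.card_eq_fintype_card]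
    refine Nat.card_congr (Quotient.congr (Equiv.refl _) fun a b => ?_)
    constructor
    · rintro ⟨g, hg⟩
      exact ⟨g, Subtype.ext hg⟩
    · rintro ⟨g, hg⟩
      exact ⟨g, congrArg Subtype.val hg⟩
  have hB := MulAction.sum_card_fixedBy_eq_card_orbits_mul_card_group G Y
  rw [hcls, Nat.card_eq_fintype_card (α := G), ← hB, finsum_eq_sum_of_fintype]
  have e1 : (∑ g : G, Fintype.card (MulAction.fixedBy Y g)) =
      Nat.card {p : G × Y // p.1 • p.2 = p.2} := by
    rw [← Fintype.card_sigma, ← Nat.card_eq_fintype_card]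
    refine Nat.card_congr ⟨fun p => ⟨(p.1, p.2.1), p.2.2⟩, fun p => ⟨p.1.1, p.1.2, p.2⟩,
      fun _ => rfl, fun _ => rfl⟩
  have e2 : (∑ g : G, Nat.card {x : X // g • τ x = x}) =
      Nat.card {p : G × X // p.1 • τ p.2 = p.2} := by
    rw [← Nat.card_sigma]
    refine Nat.card_congr ⟨fun p => ⟨(p.1, p.2.1), p.2.2⟩, fun p => ⟨p.1.1, p.1.2, p.2⟩,
      fun _ => rfl, fun _ => rfl⟩
  have e3 : Nat.card {p : G × Y // p.1 • p.2 = p.2} =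
      ∑ y : Y, Nat.card (MulAction.stabilizer G (y : X)) := by
    rw [← Nat.card_sigma]
    refine Nat.card_congr ⟨fun p => ⟨p.1.2, p.1.1, congrArg Subtype.val p.2⟩,
      fun p => ⟨(p.2.1, p.1), Subtype.ext p.2.2⟩, fun _ => rfl, fun _ => rfl⟩
  -- Points outside `Y` contribute nothing: `g • τ x = x` already puts `τ x` in the orbit of `x`.
  have e4 : Nat.card {p : G × X // p.1 • τ p.2 = p.2} =
      ∑ y : Y, Nat.card {g : G // g • τ y = y} := by
    rw [← Nat.card_sigma]
    refine Nat.card_congr ⟨fun p => ⟨⟨p.1.2, ⟨p.1.1⁻¹, by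
        rw [inv_smul_eq_iff]; exact p.2.symm⟩⟩, p.1.1, p.2⟩,
      fun p => ⟨(p.2.1, p.1), p.2.2⟩, fun _ => rfl, fun _ => rfl⟩
  rw [e1, e2, e3, e4]
  refine Finset.sum_congr rfl fun y _ => ?_
  obtain ⟨h, hh⟩ := y.2
  exact (card_eq_card_stabilizer hh.symm).symm

end Nilpotent3
end

noncomputable section

namespace Nilpotent3

open Function Equiv.Perm

/-! ### Minimal periods of permutations -/

theorem minimalPeriod_perm_pos {Z : Type*} [Finite Z] (T : Equiv.Perm Z) (z : Z) :
    0 < minimalPeriod T z := by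
  refine IsPeriodicPt.minimalPeriod_pos (orderOf_pos T) ?_
  change T^[orderOf T] z = z
  rw [iterate_eq_pow, pow_orderOf_eq_one, one_apply]

theorem pow_apply_eq_iff_dvd {Z : Type*} (T : Equiv.Perm Z) (n : ℕ) (z : Z) :
    (T ^ n) z = z ↔ minimalPeriod T z ∣ n := by
  rw [← isPeriodicPt_iff_minimalPeriod_dvd, ← iterate_eq_pow]
  rfl

theorem zpow_apply_eq_iff_dvd {Z : Type*} (T : Equiv.Perm Z) (n : ℤ) (z : Z) :
    (T ^ n) z = z ↔ (minimalPeriod T z : ℤ) ∣ n :=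
  MulAction.zpow_smul_eq_iff_minimalPeriod_dvd (a := T) (b := z)

theorem sameCycle_iff_exists_lt {Z : Type*} [Finite Z] (T : Equiv.Perm Z) (x y : Z) :
    SameCycle T x y ↔ ∃ d < minimalPeriod T x, (T ^ d) x = y := by
  constructor
  · intro h
    obtain ⟨n, rfl⟩ := h.exists_nat_pow_eq
    refine ⟨n % minimalPeriod T x, Nat.mod_lt _ (minimalPeriod_perm_pos T x), ?_⟩
    rw [← iterate_eq_pow, ← iterate_eq_pow, iterate_mod_minimalPeriod_eq]
  · rintro ⟨d, -, rfl⟩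
    exact ⟨d, by simp⟩

theorem minimalPeriod_eq_of_sameCycle {Z : Type*} {T : Equiv.Perm Z} {x y : Z}
    (h : SameCycle T x y) : minimalPeriod T x = minimalPeriod T y := by
  obtain ⟨n, rfl⟩ := h
  have key : ∀ m : ℕ, (T ^ m) x = x ↔ (T ^ m) ((T ^ n) x) = (T ^ n) x := by
    intro m
    rw [← mul_apply, ← zpow_natCast, ← zpow_add, add_comm, zpow_add, mul_apply,
      EmbeddingLike.apply_eq_iff_eq]
  exact Nat.dvd_antisymm
    ((pow_apply_eq_iff_dvd T _ _).1 ((key _).2 ((pow_apply_eq_iff_dvd T _ _).2 dvd_rfl)))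
    ((pow_apply_eq_iff_dvd T _ _).1 ((key _).1 ((pow_apply_eq_iff_dvd T _ _).2 dvd_rfl)))

theorem prod_sameCycle {Z M : Type*} [Fintype Z] [CommMonoid M] (T : Equiv.Perm Z)
    [DecidableRel (SameCycle T)] (x : Z) (h : Z → M) :
    ∏ y with SameCycle T x y, h y = ∏ d ∈ Finset.range (minimalPeriod T x), h ((T ^ d) x) := by
  symm
  refine Finset.prod_bij (fun d _ => (T ^ d) x) ?_ ?_ ?_ ?_
  · intro d hd
    simp only [Finset.mem_filter, Finset.mem_univ, true_and]
    exact ⟨d, by simp⟩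
  · intro d hd d' hd' e
    rw [← iterate_eq_pow, ← iterate_eq_pow] at e
    exact (iterate_eq_iterate_iff_of_lt_minimalPeriod (Finset.mem_range.1 hd)
      (Finset.mem_range.1 hd')).1 e
  · intro y hy
    obtain ⟨d, hd, e⟩ := (sameCycle_iff_exists_lt T x y).1 (Finset.mem_filter.1 hy).2
    exact ⟨d, Finset.mem_range.2 hd, e⟩
  · intros
    rfl

theorem card_sameCycle {Z : Type*} [Fintype Z] (T : Equiv.Perm Z) [DecidableRel (SameCycle T)]
    (x : Z) : (Finset.univ.filter fun y => SameCycle T x y).card = minimalPeriod T x := by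
  have h := prod_sameCycle T x (fun _ => Multiplicative.ofAdd 1)
  simpa [← ofAdd_nsmul] using h

/-! ### Equivariant maps -/

/-- The number of fixed points of a permutation. -/
def numFixed {W : Type*} (ρ : Equiv.Perm W) : ℕ := Nat.card {w // ρ w = w}

/-- Equivariant maps are determined by their values at representatives of the cycles. -/
def equivariantEquiv {Z W : Type*} (T : Equiv.Perm Z) (ρ : Equiv.Perm W) :
    {f : Z → W // ∀ z, f (T z) = ρ (f z)} ≃
      ∀ o : Quotient (SameCycle.setoid T), {w // (ρ ^ minimalPeriod T o.out) w = w} :=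
  have hf : ∀ f : {f : Z → W // ∀ z, f (T z) = ρ (f z)}, ∀ (n : ℤ) z,
      f.1 ((T ^ n) z) = (ρ ^ n) (f.1 z) := by
    intro f n
    induction n using Int.induction_on with
    | zero => simp
    | succ i ih => intro z; rw [add_comm, zpow_add, zpow_add, mul_apply, mul_apply,
        zpow_one, zpow_one, f.2, ih]
    | pred i ih =>
      intro z
      rw [sub_eq_neg_add, zpow_add, zpow_add, mul_apply, mul_apply, ← ih, zpow_neg_one,
        zpow_neg_one, Equiv.Perm.eq_inv_iff_eq, ← f.2, ← mul_apply, mul_inv_cancel,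
        one_apply]
  have hr : ∀ z, ∃ n : ℤ, (T ^ n) (Quotient.mk (SameCycle.setoid T) z).out = z := fun z =>
    Quotient.mk_out (s := SameCycle.setoid T) z
  -- Well-definedness of the extension that sends `(T ^ m) o.out` to `(ρ ^ m) w`: two admissible
  -- exponents differ by a multiple of the cycle length, and `ρ` to that length fixes `w`.
  have hw : ∀ (o : Quotient (SameCycle.setoid T)) (w : W),
      (ρ ^ minimalPeriod T o.out) w = w → ∀ m n : ℤ, (T ^ m) o.out = (T ^ n) o.out →
      (ρ ^ m) w = (ρ ^ n) w := by
    intro o w hw m n h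
    have h1 : (T ^ (m - n)) o.out = o.out := by
      rw [sub_eq_neg_add, zpow_add, mul_apply, h, zpow_neg, ← mul_apply, inv_mul_cancel,
        one_apply]
    have h2 : (ρ ^ (m - n)) w = w := by
      rw [zpow_apply_eq_iff_dvd] at h1 ⊢
      rw [pow_apply_eq_iff_dvd] at hw
      exact (Int.natCast_dvd_natCast.2 hw).trans h1
    rw [← sub_add_cancel m n, add_comm, zpow_add, mul_apply, h2]
  { toFun := fun f o => ⟨f.1 o.out, by
      have := hf f (minimalPeriod T o.out) o.out
      rw [zpow_natCast, zpow_natCast] at this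
      rw [← this, (pow_apply_eq_iff_dvd T _ _).2 dvd_rfl]⟩
    invFun := fun g => ⟨fun z => (ρ ^ (hr z).choose) (g (Quotient.mk (SameCycle.setoid T) z)).1, by
      intro z
      have hq : Quotient.mk (SameCycle.setoid T) (T z) = Quotient.mk (SameCycle.setoid T) z :=
        Quotient.sound (s := SameCycle.setoid T) ⟨-1, by simp⟩
      change (ρ ^ (hr (T z)).choose) (g (Quotient.mk (SameCycle.setoid T) (T z))).1 =
        ρ ((ρ ^ (hr z).choose) (g (Quotient.mk (SameCycle.setoid T) z)).1)
      have h1 := (hr (T z)).choose_spec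
      have h2 := (hr z).choose_spec
      generalize (hr (T z)).choose = m at h1 ⊢
      generalize (hr z).choose = n at h2 ⊢
      rw [hq] at h1 ⊢
      rw [← mul_apply, ← zpow_one_add]
      refine hw _ _ (g _).2 _ _ ?_
      rw [h1, zpow_one_add, mul_apply, h2]⟩
    left_inv := fun f => Subtype.ext <| funext fun z => by
      change (ρ ^ (hr z).choose) (f.1 _) = f.1 z
      rw [← hf, (hr z).choose_spec]
    right_inv := fun g => funext fun o => Subtype.ext <| by
      change (ρ ^ (hr o.out).choose) (g (Quotient.mk (SameCycle.setoid T) o.out)).1 = (g o).1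
      have h1 := (hr o.out).choose_spec
      generalize (hr o.out).choose = n at h1 ⊢
      rw [Quotient.out_eq] at h1 ⊢
      exact hw o _ (g o).2 n 0 (by simpa using h1) }

/-- A cycle of length ℓ contributes the number of fixed points of `ρ ^ ℓ`. Giving each of its ℓ
points the ℓ-th root of this number turns the product over cycles into a product over points, which
is easier to rearrange. -/
theorem card_equivariant {Z W : Type*} [Fintype Z] [Finite W] (T : Equiv.Perm Z)
    (ρ : Equiv.Perm W) :
    (Nat.card {f : Z → W // ∀ z, f (T z) = ρ (f z)} : ℝ) =
      ∏ z, (numFixed (ρ ^ minimalPeriod T z) : ℝ) ^ ((minimalPeriod T z : ℝ)⁻¹) := by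
  classical
  rw [Nat.card_congr (equivariantEquiv T ρ), Nat.card_pi, Nat.cast_prod,
    ← Finset.prod_fiberwise Finset.univ (Quotient.mk (SameCycle.setoid T))]
  refine Finset.prod_congr rfl fun o _ => ?_
  have h1 : ∀ z ∈ Finset.univ.filter (fun z => Quotient.mk (SameCycle.setoid T) z = o),
      (numFixed (ρ ^ minimalPeriod T z) : ℝ) ^ ((minimalPeriod T z : ℝ)⁻¹) =
        (numFixed (ρ ^ minimalPeriod T o.out) : ℝ) ^ ((minimalPeriod T o.out : ℝ)⁻¹) := by
    intro z hz
    have hz' : SameCycle T z o.out := by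
      have h := Quotient.mk_out (s := SameCycle.setoid T) z
      rw [(Finset.mem_filter.1 hz).2] at h
      exact SameCycle.symm h
    rw [minimalPeriod_eq_of_sameCycle hz']
  have h2 : (Finset.univ.filter (fun z => Quotient.mk (SameCycle.setoid T) z = o)).card =
      minimalPeriod T o.out := by
    rw [← card_sameCycle]
    congr 1
    ext z
    simp only [Finset.mem_filter, Finset.mem_univ, true_and]
    conv_lhs => rw [← Quotient.out_eq o]
    exact ⟨fun h => SameCycle.symm (Quotient.exact (s := SameCycle.setoid T) h),
      fun h => Quotient.sound (s := SameCycle.setoid T) (SameCycle.symm h)⟩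
  rw [Finset.prod_congr rfl h1, Finset.prod_const, h2, ← Real.rpow_natCast, ← Real.rpow_mul
    (Nat.cast_nonneg _), inv_mul_cancel₀, Real.rpow_one]
  · rfl
  · exact_mod_cast (minimalPeriod_perm_pos T _).ne'

end Nilpotent3
end

noncomputable section

namespace Nilpotent3

open Function Equiv.Perm

/-! ### The permutation `(x, y) ↦ (σ y, σ x)` -/

/-- The permutation `(x, y) ↦ (σ y, σ x)` of pairs. -/
def twist {A : Type*} (σ : Equiv.Perm A) : Equiv.Perm (A × A) :=
  (Equiv.prodComm A A).trans (σ.prodCongr σ)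

theorem twist_apply {A : Type*} (σ : Equiv.Perm A) (z : A × A) :
    twist σ z = (σ z.2, σ z.1) := rfl

theorem twist_pow_apply {A : Type*} (σ : Equiv.Perm A) (n : ℕ) (x y : A) :
    (twist σ ^ n) (x, y) =
      if Even n then ((σ ^ n) x, (σ ^ n) y) else ((σ ^ n) y, (σ ^ n) x) := by
  induction n with
  | zero => simp
  | succ n ih =>
    rw [pow_succ', mul_apply, ih]
    by_cases h : Even n <;> simp [h, Nat.even_add_one, twist_apply, pow_succ']

theorem minimalPeriod_twist_dvd_iff {A : Type*} (σ : Equiv.Perm A) (n : ℕ) (x y : A) :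
    minimalPeriod (twist σ) (x, y) ∣ n ↔
      (Even n ∧ minimalPeriod σ x ∣ n ∧ minimalPeriod σ y ∣ n) ∨
        (¬ Even n ∧ (σ ^ n) y = x ∧ (σ ^ n) x = y) := by
  rw [← pow_apply_eq_iff_dvd, twist_pow_apply, ← pow_apply_eq_iff_dvd, ← pow_apply_eq_iff_dvd]
  by_cases h : Even n <;> simp [h]

/-- An odd power exchanges the coordinates, so it could fix the pair only if `x` and `y` shared a
cycle. -/
theorem minimalPeriod_twist_of_not_sameCycle {A : Type*} (σ : Equiv.Perm A) {x y : A}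
    (h : ¬ SameCycle σ x y) :
    minimalPeriod (twist σ) (x, y) =
      Nat.lcm 2 (Nat.lcm (minimalPeriod σ x) (minimalPeriod σ y)) := by
  -- A natural number is determined by its multiples; the later period computations use the same
  -- device.
  refine Nat.dvd_right_iff_eq.1 fun n => ?_
  rw [minimalPeriod_twist_dvd_iff, Nat.lcm_dvd_iff, Nat.lcm_dvd_iff, even_iff_two_dvd]
  refine ⟨?_, Or.inl⟩
  rintro (h' | ⟨-, -, h'⟩)
  · exact h'
  · exact absurd ⟨n, by simpa using h'⟩ h

/-- Within a cycle of length a, an odd power n fixes the pair exactly when n ≡ d and n ≡ −d modulo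
a; in particular a ∣ 2d. -/
theorem minimalPeriod_twist_pow_dvd_iff {A : Type*} (σ : Equiv.Perm A) (n d : ℕ) (x : A) :
    minimalPeriod (twist σ) (x, (σ ^ d) x) ∣ n ↔
      (2 ∣ n ∧ minimalPeriod σ x ∣ n) ∨
        (¬ 2 ∣ n ∧ minimalPeriod σ x ∣ n + d ∧ (minimalPeriod σ x : ℤ) ∣ n - d) := by
  have h1 : minimalPeriod σ ((σ ^ d) x) = minimalPeriod σ x :=
    (minimalPeriod_eq_of_sameCycle (⟨d, by simp⟩ : SameCycle σ x ((σ ^ d) x))).symm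
  have h2 : (σ ^ n) x = (σ ^ d) x ↔ (minimalPeriod σ x : ℤ) ∣ n - d := by
    rw [← zpow_apply_eq_iff_dvd, sub_eq_neg_add, zpow_add, mul_apply, zpow_neg, inv_eq_iff_eq]
    simp
  rw [minimalPeriod_twist_dvd_iff, h1, even_iff_two_dvd, h2, ← mul_apply, ← pow_add,
    pow_apply_eq_iff_dvd, and_self_iff]

theorem minimalPeriod_twist_self {A : Type*} (σ : Equiv.Perm A) (x : A) :
    minimalPeriod (twist σ) (x, (σ ^ 0) x) = minimalPeriod σ x := by
  refine Nat.dvd_right_iff_eq.1 fun n => ?_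
  rw [minimalPeriod_twist_pow_dvd_iff]
  simp only [add_zero, Nat.cast_zero, sub_zero, Int.natCast_dvd_natCast]
  tauto

theorem minimalPeriod_twist_pow_of_odd {A : Type*} (σ : Equiv.Perm A) (x : A) {d : ℕ}
    (ha : minimalPeriod σ x % 2 = 1) (hd0 : d ≠ 0) (hd : d < minimalPeriod σ x) :
    minimalPeriod (twist σ) (x, (σ ^ d) x) = 2 * minimalPeriod σ x := by
  refine Nat.dvd_right_iff_eq.1 fun n => ?_
  rw [minimalPeriod_twist_pow_dvd_iff]
  generalize minimalPeriod σ x = a at *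
  have hc : Nat.Coprime 2 a := (Nat.coprime_two_left).2 (Nat.odd_iff.2 ha)
  have h2a : 2 * a ∣ n ↔ 2 ∣ n ∧ a ∣ n :=
    ⟨fun h => ⟨(Dvd.intro _ rfl).trans h, (Dvd.intro_left _ rfl).trans h⟩,
      fun h => hc.mul_dvd_of_dvd_of_dvd h.1 h.2⟩
  rw [h2a]
  refine ⟨?_, Or.inl⟩
  rintro (h | ⟨-, h1, h2⟩)
  · exact h
  · exfalso
    have h3 : (a : ℤ) ∣ ((2 * d : ℕ) : ℤ) := by
      have h4 : (a : ℤ) ∣ ((n + d : ℕ) : ℤ) := Int.natCast_dvd_natCast.2 h1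
      have := dvd_sub h4 h2
      convert! this using 1
      push_cast
      ring
    have h5 := hc.symm.dvd_of_dvd_mul_left (Int.natCast_dvd_natCast.1 h3)
    exact absurd (Nat.le_of_dvd (Nat.pos_of_ne_zero hd0) h5) (by omega)

/-- An odd return time n would give a ∣ 2d, so d = 0 or d = a/2. In the first case n is a multiple
of the even number a; in the second 4 ∣ a and n ≡ a/2 modulo a. Either way n is even. -/
theorem minimalPeriod_twist_pow_of_even {A : Type*} (σ : Equiv.Perm A) (x : A) {d : ℕ}
    (ha : minimalPeriod σ x % 2 = 0) (hd : d < minimalPeriod σ x)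
    (h : minimalPeriod σ x % 4 = 0 ∨ d ≠ minimalPeriod σ x / 2) :
    minimalPeriod (twist σ) (x, (σ ^ d) x) = minimalPeriod σ x := by
  refine Nat.dvd_right_iff_eq.1 fun n => ?_
  rw [minimalPeriod_twist_pow_dvd_iff]
  generalize minimalPeriod σ x = a at *
  constructor
  · rintro (h' | ⟨h0, h1, h2⟩)
    · exact h'.2
    · exfalso
      have h3 : (a : ℤ) ∣ ((2 * d : ℕ) : ℤ) := by
        have h4 : (a : ℤ) ∣ ((n + d : ℕ) : ℤ) := Int.natCast_dvd_natCast.2 h1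
        have := dvd_sub h4 h2
        convert! this using 1
        push_cast
        ring
      obtain ⟨c, hc⟩ := Int.natCast_dvd_natCast.1 h3
      obtain ⟨e, he⟩ := h1
      obtain ⟨b, rfl⟩ : ∃ b, a = 2 * b := ⟨a / 2, by omega⟩
      have hc2 : c < 2 := by
        by_contra hcon
        have : 2 * b * 2 ≤ 2 * b * c := Nat.mul_le_mul_left _ (by omega)
        omega
      have h2' : 2 * b * e = 2 * (b * e) := by ring
      rw [h2'] at he
      interval_cases c <;> omega
  · intro h'
    exact Or.inl ⟨(Nat.dvd_of_mod_eq_zero ha).trans h', h'⟩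

/-- Here a/2 is odd and a/2 ≡ −a/2 modulo a, so the pair of opposite points already returns after
a/2 steps. -/
theorem minimalPeriod_twist_half {A : Type*} (σ : Equiv.Perm A) (x : A)
    (ha : minimalPeriod σ x % 4 = 2) :
    minimalPeriod (twist σ) (x, (σ ^ (minimalPeriod σ x / 2)) x) = minimalPeriod σ x / 2 := by
  refine Nat.dvd_right_iff_eq.1 fun n => ?_
  rw [minimalPeriod_twist_pow_dvd_iff]
  generalize minimalPeriod σ x = a at *
  obtain ⟨b, rfl⟩ : ∃ b, a = 2 * b := ⟨a / 2, by omega⟩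
  rw [Nat.mul_div_cancel_left _ two_pos]
  have hc : Nat.Coprime 2 b := (Nat.coprime_two_left).2 (Nat.odd_iff.2 (by omega))
  constructor
  · rintro (h' | ⟨-, h1, -⟩)
    · exact (Dvd.intro_left _ rfl).trans h'.2
    · exact (Nat.dvd_add_left dvd_rfl).1 ((Dvd.intro_left _ rfl).trans h1)
  · intro h'
    by_cases h2 : 2 ∣ n
    · exact Or.inl ⟨h2, hc.mul_dvd_of_dvd_of_dvd h2 h'⟩
    · refine Or.inr ⟨h2, hc.mul_dvd_of_dvd_of_dvd (by omega) (dvd_add h' dvd_rfl), ?_⟩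
      have h3 : (2 : ℤ) ∣ (n : ℤ) - b := by omega
      have h4 : (b : ℤ) ∣ (n : ℤ) - b := dvd_sub (Int.natCast_dvd_natCast.2 h') dvd_rfl
      have h5 : IsCoprime (2 : ℤ) (b : ℤ) := by exact_mod_cast hc.isCoprime
      push_cast
      exact h5.mul_dvd h3 h4

/-! ### The contribution of a single cycle -/

/-- The contribution of pairs of elements of the same cycle, of length `a`, where `φ e` is the
number of fixed points of an `e`-th power. -/
def diagFactor (φ : ℕ → ℝ) (a : ℕ) : ℝ :=
  if a % 2 = 1 then φ a * φ (2 * a) ^ ((a - 1) / 2)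
  else if a % 4 = 0 then φ a ^ a
  else φ (a / 2) ^ 2 * φ a ^ (a - 1)

theorem prod_range_eq_of_const_off {a d₀ : ℕ} (h0 : d₀ < a) (h : ℕ → ℝ) (c : ℝ)
    (hc : ∀ d < a, d ≠ d₀ → h d = c) : ∏ d ∈ Finset.range a, h d = h d₀ * c ^ (a - 1) := by
  rw [← Finset.mul_prod_erase _ _ (Finset.mem_range.2 h0)]
  congr 1
  rw [Finset.prod_congr rfl (g := fun _ => c), Finset.prod_const, Finset.card_erase_of_mem
    (Finset.mem_range.2 h0), Finset.card_range]
  intro d hd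
  exact hc d (Finset.mem_range.1 (Finset.mem_of_mem_erase hd)) (Finset.ne_of_mem_erase hd)

/-- For fixed `x` at most one `y` is exceptional: `x` itself if a is odd, the opposite point if a ≡
2 modulo 4, none if 4 ∣ a. The a-th root appears because the a choices of `x` share the factor of
the cycle equally. -/
theorem prod_sameCycle_twist {A : Type*} [Fintype A] (σ : Equiv.Perm A)
    [DecidableRel (SameCycle σ)] (x : A) (φ : ℕ → ℝ) (hφ : ∀ e, 0 ≤ φ e) :
    ∏ y with SameCycle σ x y, φ (minimalPeriod (twist σ) (x, y)) ^
        ((minimalPeriod (twist σ) (x, y) : ℝ)⁻¹) =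
      diagFactor φ (minimalPeriod σ x) ^ ((minimalPeriod σ x : ℝ)⁻¹) := by
  rw [prod_sameCycle]
  have hpos := minimalPeriod_perm_pos σ x
  have hpos' : (0 : ℝ) < minimalPeriod σ x := by exact_mod_cast hpos
  unfold diagFactor
  split_ifs with h1 h2
  · rw [prod_range_eq_of_const_off hpos _
      (φ (2 * minimalPeriod σ x) ^ (((2 * minimalPeriod σ x : ℕ) : ℝ)⁻¹)) fun d hd hd0 => by
        rw [minimalPeriod_twist_pow_of_odd σ x h1 hd0 hd],
      minimalPeriod_twist_self σ x, Real.mul_rpow (hφ _) (pow_nonneg (hφ _) _)]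
    congr 1
    rw [← Real.rpow_natCast, ← Real.rpow_natCast, ← Real.rpow_mul (hφ _),
      ← Real.rpow_mul (hφ _)]
    congr 1
    obtain ⟨b, hb⟩ : ∃ b, minimalPeriod σ x = 2 * b + 1 := ⟨minimalPeriod σ x / 2, by omega⟩
    rw [hb]
    rw [show (2 * b + 1 - 1) / 2 = b by omega, show 2 * b + 1 - 1 = 2 * b by omega]
    push_cast
    field_simp
  · have ha : minimalPeriod σ x % 2 = 0 := by omega
    rw [Finset.prod_congr rfl (g := fun _ => φ (minimalPeriod σ x) ^ ((minimalPeriod σ x : ℝ)⁻¹))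
      fun d hd => by
        rw [minimalPeriod_twist_pow_of_even σ x ha (Finset.mem_range.1 hd) (Or.inl h2)],
      Finset.prod_const, Finset.card_range, ← Real.rpow_natCast, ← Real.rpow_natCast,
      ← Real.rpow_mul (hφ _), ← Real.rpow_mul (hφ _), mul_comm]
  · have ha : minimalPeriod σ x % 2 = 0 := by omega
    have hlt : minimalPeriod σ x / 2 < minimalPeriod σ x := by omega
    rw [prod_range_eq_of_const_off hlt _
      (φ (minimalPeriod σ x) ^ ((minimalPeriod σ x : ℝ)⁻¹)) fun d hd hd0 => by
        rw [minimalPeriod_twist_pow_of_even σ x ha hd (Or.inr hd0)],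
      minimalPeriod_twist_half σ x (by omega), Real.mul_rpow (pow_nonneg (hφ _) _)
        (pow_nonneg (hφ _) _)]
    obtain ⟨b, hb⟩ : ∃ b, minimalPeriod σ x = 2 * b := ⟨minimalPeriod σ x / 2, by omega⟩
    rw [hb] at hpos ⊢
    have hb0 : (b : ℝ) ≠ 0 := by
      have : b ≠ 0 := by omega
      exact_mod_cast this
    rw [Nat.mul_div_cancel_left _ two_pos]
    congr 1
    · rw [← Real.rpow_natCast, ← Real.rpow_mul (hφ _)]
      congr 1
      push_cast
      field_simp
    · rw [← Real.rpow_natCast, ← Real.rpow_natCast, ← Real.rpow_mul (hφ _),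
        ← Real.rpow_mul (hφ _), mul_comm _ (((2 * b : ℕ) : ℝ)⁻¹)]

end Nilpotent3
end

noncomputable section

namespace Nilpotent3

open Function Equiv.Perm

/-! ### Cycle types as partitions -/

theorem card_support_cycleOf {A : Type*} [Fintype A] [DecidableEq A] (σ : Equiv.Perm A) {x : A}
    (hx : x ∈ σ.support) : (cycleOf σ x).support.card = minimalPeriod σ x := by
  rw [← card_sameCycle]
  congr 1
  ext y
  rw [mem_support_cycleOf_iff, Finset.mem_filter]
  simp only [hx, Finset.mem_univ, true_and, and_true]

/-- The points of period d fill the d-cycles. The case d = 1 is separate because `cycleType` omits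
fixed points, which `partition` restores as ones. -/
theorem card_minimalPeriod_eq {A : Type*} [Fintype A] [DecidableEq A] (σ : Equiv.Perm A)
    (d : ℕ) :
    (Finset.univ.filter fun x => minimalPeriod σ x = d).card = d * mult σ.partition d := by
  rcases Nat.lt_trichotomy d 1 with hd | rfl | hd
  · obtain rfl : d = 0 := by omega
    rw [zero_mul, Finset.card_eq_zero, Finset.filter_eq_empty_iff]
    exact fun x _ => (minimalPeriod_perm_pos σ x).ne'
  · have h1 : σ.cycleType.count 1 = 0 := Multiset.count_eq_zero.2 fun h =>
      absurd (one_lt_of_mem_cycleType h) (lt_irrefl _)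
    rw [mult, parts_partition, Multiset.count_add, h1, Multiset.count_replicate_self, zero_add,
      one_mul, ← Finset.card_compl]
    congr 1
    ext x
    simp [minimalPeriod_eq_one_iff_isFixedPt, IsFixedPt]
  · have h1 : (Multiset.replicate (Fintype.card A - σ.support.card) 1).count d = 0 :=
      Multiset.count_eq_zero.2 fun h => by
        have := Multiset.eq_of_mem_replicate h
        omega
    have h2 : (Finset.univ.filter fun x => minimalPeriod σ x = d) =
        (σ.cycleFactorsFinset.filter fun c => d = c.support.card).biUnion support := by
      ext x
      simp only [Finset.mem_filter, Finset.mem_univ, true_and, Finset.mem_biUnion]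
      constructor
      · intro hx
        have hs : x ∈ σ.support := by
          rw [Equiv.Perm.mem_support]
          intro h
          rw [← IsFixedPt, ← minimalPeriod_eq_one_iff_isFixedPt] at h
          omega
        exact ⟨cycleOf σ x, ⟨cycleOf_mem_cycleFactorsFinset_iff.2 hs,
          by rw [card_support_cycleOf σ hs, hx]⟩, by
          rw [mem_support_cycleOf_iff]; exact ⟨SameCycle.refl _ _, hs⟩⟩
      · rintro ⟨c, ⟨hc, hd⟩, hx⟩
        have hs : x ∈ σ.support := mem_cycleFactorsFinset_support_le hc hx
        rw [hd, cycle_is_cycleOf hx hc, card_support_cycleOf σ hs]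
    rw [mult, parts_partition, Multiset.count_add, h1, add_zero, cycleType_def, Multiset.count_map,
      h2, Finset.card_biUnion]
    · rw [Finset.sum_congr rfl (g := fun _ => d) fun c hc => (Finset.mem_filter.1 hc).2.symm,
        Finset.sum_const, smul_eq_mul, mul_comm]
      rfl
    · intro c hc c' hc' hne
      exact ((cycleFactorsFinset_pairwise_disjoint σ) (Finset.mem_filter.1 hc).1
        (Finset.mem_filter.1 hc').1 hne).disjoint_support

theorem card_filter_pow_eq {A : Type*} [Fintype A] [DecidableEq A] (σ : Equiv.Perm A) {e : ℕ}
    (he : e ≠ 0) :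
    (Finset.univ.filter fun x => (σ ^ e) x = x).card =
      ∑ d ∈ e.divisors, d * mult σ.partition d := by
  rw [Finset.card_eq_sum_card_fiberwise (f := fun x => minimalPeriod σ x) (t := e.divisors)]
  · refine Finset.sum_congr rfl fun d hd => ?_
    rw [← card_minimalPeriod_eq, Finset.filter_filter]
    congr 1
    ext x
    simp only [Finset.mem_filter, Finset.mem_univ, true_and, pow_apply_eq_iff_dvd]
    refine ⟨fun h => h.2, fun h => ⟨?_, h⟩⟩
    rw [h]
    exact Nat.dvd_of_mem_divisors hd
  · intro x hx
    simp only [Finset.coe_filter, Finset.mem_univ, true_and, Set.mem_ofPred_eq,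
      pow_apply_eq_iff_dvd] at hx
    exact Finset.mem_coe.2 (Nat.mem_divisors.2 ⟨hx, he⟩)

/-! ### Fixed points on C ∪ {0}. -/

theorem optionCongr_pow {C : Type*} (π : Equiv.Perm C) (e : ℕ) :
    (Equiv.optionCongr π ^ e : Equiv.Perm (Option C)) = Equiv.optionCongr (π ^ e) := by
  induction e with
  | zero => ext x; cases x <;> simp
  | succ e ih => rw [pow_succ, ih]; ext x; cases x <;> simp [pow_succ]

/-- The point `none`, the zero, is always fixed; this is the 1 in `cycleSum`. -/
theorem numFixed_optionCongr_pow {C : Type*} [Fintype C] [DecidableEq C] (π : Equiv.Perm C)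
    {e : ℕ} (he : e ≠ 0) :
    (numFixed (Equiv.optionCongr π ^ e : Equiv.Perm (Option C)) : ℝ) =
      cycleSum π.partition e := by
  have h1 : numFixed (Equiv.optionCongr π ^ e : Equiv.Perm (Option C)) =
      Nat.card (Option {c // (π ^ e) c = c}) := by
    rw [optionCongr_pow]
    symm
    refine Nat.card_eq_of_bijective (fun w => ⟨w.map Subtype.val, ?_⟩) ⟨?_, ?_⟩
    · cases w with
      | none => rfl
      | some c => exact congrArg some c.2
    · intro w w' h
      exact Option.map_injective Subtype.val_injective (congrArg Subtype.val h)
    · rintro ⟨_ | c, hc⟩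
      · exact ⟨none, rfl⟩
      · exact ⟨some ⟨c, by simpa using hc⟩, rfl⟩
  rw [h1, Finite.card_option, Nat.card_eq_fintype_card, Fintype.card_subtype,
    card_filter_pow_eq π he, cycleSum]
  push_cast
  ring

/-! ### Centralizer orders and sizes of conjugacy classes. -/

theorem mult_eq_zero {n : ℕ} (j : n.Partition) {i : ℕ} (hi : i ∉ Finset.Icc 1 n) :
    mult j i = 0 := by
  refine Multiset.count_eq_zero.2 fun h => hi (Finset.mem_Icc.2 ⟨j.parts_pos h, ?_⟩)
  rw [← j.parts_sum]
  exact Multiset.le_sum_of_mem h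

/-- Puts the centralizer order in the form used by `card_of_cycleType_mul_eq`, where `m` is a cycle
type without fixed points; the parts equal to 1 account for `(n - m.sum)!`. -/
theorem centralizerOrder_eq {n : ℕ} (j : n.Partition) (m : Multiset ℕ)
    (hm : m = j.parts.filter fun i => 2 ≤ i) :
    centralizerOrder j =
      (((n - m.sum).factorial * m.prod * ∏ i ∈ m.toFinset, (m.count i).factorial : ℕ) : ℝ) := by
  have hcount : ∀ i ∈ m.toFinset, m.count i = mult j i := by
    intro i hi
    subst hm
    rw [Multiset.mem_toFinset, Multiset.mem_filter] at hi
    rw [Multiset.count_filter, if_pos hi.2, mult]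
  have hsum : n - m.sum = mult j 1 := by
    have h1 : j.parts.filter (fun i => 2 ≤ i) + j.parts.filter (fun i => ¬ 2 ≤ i) = j.parts :=
      Multiset.filter_add_not _ _
    have h2 : j.parts.filter (fun i => ¬ 2 ≤ i) = Multiset.replicate (mult j 1) 1 := by
      rw [mult, ← Multiset.filter_eq']
      refine Multiset.filter_congr fun i hi => ?_
      have := j.parts_pos hi
      omega
    have h3 := congrArg Multiset.sum h1
    rw [Multiset.sum_add, h2, Multiset.sum_replicate, j.parts_sum, smul_eq_mul, mul_one,
      ← hm] at h3
    omega
  have h1m : 1 ∉ m.toFinset := by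
    subst hm
    simp
  have hset : centralizerOrder j =
      ∏ i ∈ insert 1 m.toFinset, ((mult j i).factorial : ℝ) * (i : ℝ) ^ mult j i := by
    rw [centralizerOrder, ← Finset.prod_subset (s₁ := j.parts.toFinset)]
    · refine Finset.prod_subset ?_ ?_
      · intro i hi
        rw [Multiset.mem_toFinset] at hi
        rw [Finset.mem_insert, Multiset.mem_toFinset, hm, Multiset.mem_filter]
        have := j.parts_pos hi
        by_cases h : i = 1
        · exact Or.inl h
        · exact Or.inr ⟨hi, by omega⟩
      · intro i _ hi
        rw [Multiset.mem_toFinset, ← Multiset.count_eq_zero] at hi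
        simp [mult, hi]
    · intro i hi
      by_contra h
      exact Multiset.mem_toFinset.1 hi |> Multiset.count_pos.2 |>.ne' (mult_eq_zero j h)
    · intro i _ hi
      rw [Multiset.mem_toFinset, ← Multiset.count_eq_zero] at hi
      simp [mult, hi]
  rw [hset, Finset.prod_insert h1m, Finset.prod_multiset_count m, hsum, mul_assoc,
    Nat.cast_one, one_pow, one_mul, Finset.prod_mul_distrib]
  push_cast
  rw [mul_assoc, mul_comm (∏ i ∈ m.toFinset, (i : ℝ) ^ _)]
  congr 2 <;> exact Finset.prod_congr rfl fun i hi => by rw [hcount i hi]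

theorem centralizerOrder_ne_zero {n : ℕ} (j : n.Partition) : centralizerOrder j ≠ 0 := by
  refine Finset.prod_ne_zero_iff.2 fun i hi => mul_ne_zero ?_ (pow_ne_zero _ ?_)
  · exact_mod_cast Nat.factorial_ne_zero _
  · have := (Finset.mem_Icc.1 hi).1
    exact_mod_cast (by omega : i ≠ 0)

theorem card_partition_eq {A : Type*} [Fintype A] [DecidableEq A]
    (j : (Fintype.card A).Partition) :
    ((Finset.univ.filter fun σ : Equiv.Perm A => σ.partition = j).card : ℝ) =
      (Fintype.card A).factorial * (centralizerOrder j)⁻¹ := by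
  set m := j.parts.filter fun i => 2 ≤ i with hm
  -- The parts that are at least 2 determine the partition, since the number of ones is what remains
  -- of the total.
  have hset : (Finset.univ.filter fun σ : Equiv.Perm A => σ.partition = j) =
      Finset.univ.filter fun σ : Equiv.Perm A => σ.cycleType = m := by
    refine Finset.filter_congr fun σ _ => ?_
    constructor
    · rintro rfl
      exact filter_parts_partition_eq_cycleType.symm
    · intro h
      have h1 : j.parts.filter (fun i => 2 ≤ i) + j.parts.filter (fun i => ¬ 2 ≤ i) = j.parts :=
        Multiset.filter_add_not _ _
      have h2 : j.parts.filter (fun i => ¬ 2 ≤ i) = Multiset.replicate (j.parts.count 1) 1 := by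
        rw [← Multiset.filter_eq']
        refine Multiset.filter_congr fun i hi => ?_
        have := j.parts_pos hi
        omega
      have h3 := congrArg Multiset.sum h1
      rw [Multiset.sum_add, h2, Multiset.sum_replicate, j.parts_sum, smul_eq_mul, mul_one,
        ← hm] at h3
      rw [Nat.Partition.ext_iff, parts_partition, ← h1, h2, ← hm, h, ← sum_cycleType, h]
      congr 2
      omega
  have hle : m.sum ≤ Fintype.card A := by
    have h := congrArg Multiset.sum (Multiset.filter_add_not (fun i => 2 ≤ i) j.parts)
    rw [Multiset.sum_add, j.parts_sum, ← hm] at h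
    omega
  have h := card_of_cycleType_mul_eq A m
  rw [if_pos ⟨hle, fun a ha => (Multiset.mem_filter.1 ha).2⟩] at h
  rw [eq_mul_inv_iff_mul_eq₀ (centralizerOrder_ne_zero j), centralizerOrder_eq j m hm, hset]
  exact_mod_cast h

theorem sum_perm_eq_sum_partition {A : Type*} [Fintype A] [DecidableEq A]
    (Ψ : (Fintype.card A).Partition → ℝ) :
    ∑ σ : Equiv.Perm A, Ψ σ.partition =
      (Fintype.card A).factorial * ∑ j, (centralizerOrder j)⁻¹ * Ψ j := by
  rw [← Finset.sum_fiberwise Finset.univ (fun σ : Equiv.Perm A => σ.partition), Finset.mul_sum]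
  refine Finset.sum_congr rfl fun j _ => ?_
  rw [Finset.sum_congr rfl (g := fun _ => Ψ j) fun σ hσ => by rw [(Finset.mem_filter.1 hσ).2],
    Finset.sum_const, nsmul_eq_mul, card_partition_eq, mul_assoc]

end Nilpotent3
end

noncomputable section

namespace Nilpotent3

open Function Equiv.Perm

/-! ### The number of tables fixed by a twisted action -/

theorem minimalPeriod_mem_Icc {A : Type*} [Fintype A] (σ : Equiv.Perm A) (x : A) :
    minimalPeriod σ x ∈ Finset.Icc 1 (Fintype.card A) := by
  classical
  refine Finset.mem_Icc.2 ⟨minimalPeriod_perm_pos σ x, ?_⟩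
  rw [← card_sameCycle]
  exact Finset.card_le_univ _

theorem prod_minimalPeriod {A : Type*} [Fintype A] [DecidableEq A] (σ : Equiv.Perm A)
    (h : ℕ → ℝ) :
    ∏ x, h (minimalPeriod σ x) =
      ∏ a ∈ Finset.Icc 1 (Fintype.card A), h a ^ (a * mult σ.partition a) := by
  rw [← Finset.prod_fiberwise_of_maps_to (s := Finset.univ) (g := fun x => minimalPeriod σ x)
    (t := Finset.Icc 1 (Fintype.card A)) (fun x _ => minimalPeriod_mem_Icc σ x)]
  refine Finset.prod_congr rfl fun a _ => ?_
  rw [Finset.prod_congr rfl (g := fun _ => h a) fun x hx => by rw [(Finset.mem_filter.1 hx).2],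
    Finset.prod_const, card_minimalPeriod_eq]

/-- Each unordered pair of distinct indices occurs twice, whence the 2 in the exponent of p_{a,b}
for b < a. -/
theorem prod_Icc_prod_Icc_symm (c : ℕ → ℕ → ℝ) (hc : ∀ a b, c a b = c b a) (n : ℕ) :
    ∏ a ∈ Finset.Icc 1 n, ∏ b ∈ Finset.Icc 1 n, c a b =
      ∏ a ∈ Finset.Icc 1 n, (c a a * ∏ b ∈ Finset.Icc 1 (a - 1), c a b ^ 2) := by
  induction n with
  | zero => simp
  | succ n ih =>
    rw [Finset.prod_Icc_succ_top (by omega), Finset.prod_Icc_succ_top (by omega),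
      Finset.prod_Icc_succ_top (by omega), ← ih,
      Finset.prod_congr rfl fun a _ => Finset.prod_Icc_succ_top (by omega : 1 ≤ n + 1) _,
      Finset.prod_mul_distrib, Nat.add_sub_cancel, Finset.prod_pow,
      Finset.prod_congr rfl fun a _ => hc a (n + 1)]
    ring

theorem cycleSum_pos {n : ℕ} (j : n.Partition) (e : ℕ) : 0 < cycleSum j e := by
  unfold cycleSum
  positivity

theorem pFactor_pos {n : ℕ} (j : n.Partition) (a b : ℕ) : 0 < pFactor j a b :=
  Real.rpow_pos_of_pos (cycleSum_pos j _) _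

theorem pFactor_comm {n : ℕ} (j : n.Partition) (a b : ℕ) : pFactor j a b = pFactor j b a := by
  rw [pFactor, pFactor, Nat.lcm_comm a b, mul_comm]

theorem qFactor_pos {n : ℕ} (j : n.Partition) (a : ℕ) : 0 < qFactor j a := by
  have := cycleSum_pos j
  unfold qFactor
  split_ifs
  · exact mul_pos (this _) (pow_pos (this _) _)
  · exact pow_pos (this _) _
  · exact mul_pos (pow_pos (this _) _) (pow_pos (this _) _)

/-- The product over the cycle type `k` in the second sum of `L(p,q)`. -/
def twistedProduct {c a : ℕ} (j : c.Partition) (k : a.Partition) : ℝ :=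
  ∏ i ∈ Finset.Icc 1 a, (qFactor j i ^ mult k i * pFactor j i i ^ (mult k i ^ 2 - mult k i) *
    ∏ b ∈ Finset.Icc 1 (i - 1), pFactor j i b ^ (2 * mult k i * mult k b))

/-- For each `x`, the `y` in its own cycle give the root of q_a. The others are obtained by
pretending that every pair has period lcm(2, a, b) and dividing out the own cycle; this division
turns the exponent k_a² of p_{a,a} into k_a² − k_a. -/
theorem prod_minimalPeriod_twist {A : Type*} [Fintype A] [DecidableEq A] (σ : Equiv.Perm A)
    {c : ℕ} (j : c.Partition) :
    ∏ z : A × A, cycleSum j (minimalPeriod (twist σ) z) ^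
        ((minimalPeriod (twist σ) z : ℝ)⁻¹) = twistedProduct j σ.partition := by
  classical
  set k := σ.partition with hk
  set φ := cycleSum j with hφ
  have hφ0 : ∀ e, 0 < φ e := cycleSum_pos j
  -- The share of a single pair from different cycles of lengths a and b; the ab pairs of two such
  -- cycles together give p_{a,b}.
  let g : ℕ → ℕ → ℝ := fun a b => φ (Nat.lcm 2 (Nat.lcm a b)) ^
    ((Nat.lcm 2 (Nat.lcm a b) : ℝ)⁻¹)
  have hg0 : ∀ a b, 0 < g a b := fun a b => Real.rpow_pos_of_pos (hφ0 _) _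
  have hgp : ∀ a b, g a b ^ (a * b) = pFactor j a b := by
    intro a b
    rw [pFactor, ← Real.rpow_natCast, ← Real.rpow_mul (hφ0 _).le, inv_mul_eq_div]
    push_cast
    rfl
  have hout : ∀ x, ∏ y with ¬ SameCycle σ x y, φ (minimalPeriod (twist σ) (x, y)) ^
      ((minimalPeriod (twist σ) (x, y) : ℝ)⁻¹) =
      (∏ b ∈ Finset.Icc 1 (Fintype.card A), g (minimalPeriod σ x) b ^ (b * mult k b)) /
        g (minimalPeriod σ x) (minimalPeriod σ x) ^ minimalPeriod σ x := by
    intro x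
    rw [eq_div_iff (pow_pos (hg0 _ _) _).ne', ← prod_minimalPeriod σ (g (minimalPeriod σ x)),
      ← Finset.prod_filter_mul_prod_filter_not Finset.univ (fun y => SameCycle σ x y), mul_comm]
    congr 1
    · rw [Finset.prod_congr rfl (g := fun _ => g (minimalPeriod σ x) (minimalPeriod σ x)),
        Finset.prod_const, card_sameCycle]
      intro y hy
      rw [minimalPeriod_eq_of_sameCycle (Finset.mem_filter.1 hy).2]
    · refine Finset.prod_congr rfl fun y hy => ?_
      rw [minimalPeriod_twist_of_not_sameCycle σ (Finset.mem_filter.1 hy).2]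
  have hsplit : ∀ x, ∏ y, φ (minimalPeriod (twist σ) (x, y)) ^
      ((minimalPeriod (twist σ) (x, y) : ℝ)⁻¹) =
      diagFactor φ (minimalPeriod σ x) ^ ((minimalPeriod σ x : ℝ)⁻¹) *
      ((∏ b ∈ Finset.Icc 1 (Fintype.card A), g (minimalPeriod σ x) b ^ (b * mult k b)) /
        g (minimalPeriod σ x) (minimalPeriod σ x) ^ minimalPeriod σ x) := by
    intro x
    rw [← Finset.prod_filter_mul_prod_filter_not Finset.univ (fun y => SameCycle σ x y),
      prod_sameCycle_twist σ x φ (fun e => (hφ0 e).le), hout]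
  rw [Fintype.prod_prod_type, Finset.prod_congr rfl fun x _ => hsplit x,
    prod_minimalPeriod σ fun a => diagFactor φ a ^ ((a : ℝ)⁻¹) *
      ((∏ b ∈ Finset.Icc 1 (Fintype.card A), g a b ^ (b * mult k b)) / g a a ^ a),
    twistedProduct]
  have hterm : ∀ a ∈ Finset.Icc 1 (Fintype.card A),
      (diagFactor φ a ^ ((a : ℝ)⁻¹) *
        ((∏ b ∈ Finset.Icc 1 (Fintype.card A), g a b ^ (b * mult k b)) / g a a ^ a)) ^
          (a * mult k a) =
      qFactor j a ^ mult k a * (pFactor j a a ^ mult k a)⁻¹ *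
        ∏ b ∈ Finset.Icc 1 (Fintype.card A), pFactor j a b ^ (mult k a * mult k b) := by
    intro a ha
    have ha0 : (a : ℝ) ≠ 0 := by
      have := (Finset.mem_Icc.1 ha).1
      exact_mod_cast (by omega : a ≠ 0)
    have h1 : (diagFactor φ a ^ ((a : ℝ)⁻¹)) ^ (a * mult k a) = qFactor j a ^ mult k a := by
      change (qFactor j a ^ ((a : ℝ)⁻¹)) ^ (a * mult k a) = _
      rw [pow_mul, ← Real.rpow_natCast _ a, ← Real.rpow_mul (qFactor_pos j a).le,
        inv_mul_cancel₀ ha0, Real.rpow_one]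
    rw [mul_pow, h1, div_pow, ← Finset.prod_pow, mul_assoc, div_eq_inv_mul]
    congr 2
    · rw [← hgp, ← pow_mul, ← pow_mul]
      ring_nf
    · refine Finset.prod_congr rfl fun b _ => ?_
      rw [← hgp, ← pow_mul, ← pow_mul]
      ring_nf
  rw [Finset.prod_congr rfl hterm, Finset.prod_mul_distrib,
    prod_Icc_prod_Icc_symm (fun a b => pFactor j a b ^ (mult k a * mult k b))
      (fun a b => by rw [pFactor_comm, mul_comm]), ← Finset.prod_mul_distrib]
  refine Finset.prod_congr rfl fun a _ => ?_
  rw [pow_sub₀ _ (pFactor_pos j a a).ne' (Nat.le_self_pow two_ne_zero _), sq (mult k a)]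
  have h2 : ∀ b ∈ Finset.Icc 1 (a - 1), (pFactor j a b ^ (mult k a * mult k b)) ^ 2 =
      pFactor j a b ^ (2 * mult k a * mult k b) := by
    intro b _
    rw [← pow_mul]
    ring_nf
  rw [Finset.prod_congr rfl h2]
  ring

/-! ### Tables and their symmetries -/

/-- Multiplication tables `A × A → C ∪ {0}`. -/
def Table (A C : Type*) : Type _ := A × A → Option C

instance {A C : Type*} [Finite A] [Finite C] : Finite (Table A C) :=
  inferInstanceAs (Finite (A × A → Option C))

instance {A C : Type*} : MulAction (Equiv.Perm A × Equiv.Perm C) (Table A C) where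
  smul g f := fun z => (f (g.1⁻¹ z.1, g.1⁻¹ z.2)).map g.2
  one_smul f := by
    funext z
    change Option.map _ _ = _
    simp
  mul_smul g h f := by
    funext z
    change Option.map _ _ = Option.map _ (Option.map _ _)
    simp [Option.map_map, Function.comp_def]

theorem Table.smul_apply {A C : Type*} (g : Equiv.Perm A × Equiv.Perm C) (f : Table A C)
    (z : A × A) : (g • f) z = (f (g.1⁻¹ z.1, g.1⁻¹ z.2)).map g.2 := rfl

/-- Tables up to renaming. -/
abbrev Table.isoRel (A C : Type*) : Setoid (Table A C) :=
  MulAction.orbitRel (Equiv.Perm A × Equiv.Perm C) (Table A C)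

theorem Table.isoRel_iff {A C : Type*} (f f' : Table A C) :
    Table.isoRel A C f f' ↔ ∃ (σ : Equiv.Perm A) (π : Equiv.Perm C),
      ∀ x y, f (σ x, σ y) = (f' (x, y)).map π := by
  constructor
  · rintro ⟨g, rfl⟩
    exact ⟨g.1, g.2, fun x y => by simp [Table.smul_apply]⟩
  · rintro ⟨σ, π, h⟩
    refine ⟨(σ, π), funext fun z => ?_⟩
    simp only [Table.smul_apply]
    rw [← h]
    simp

/-- The transposed table. -/
def Table.flip {A C : Type*} (f : Table A C) : Table A C := fun z => f z.swap

/-- A table is self-dual if it is its own transpose up to renaming. -/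
def Table.IsSelfDual {A C : Type*} (f : Table A C) : Prop := Table.isoRel A C f.flip f

theorem Table.smul_flip_eq_iff {A C : Type*} (g : Equiv.Perm A × Equiv.Perm C)
    (f : Table A C) :
    g • f.flip = f ↔ ∀ z, f (twist g.1 z) = Equiv.optionCongr g.2 (f z) := by
  constructor
  · intro h z
    conv_lhs => rw [← h]
    simp [Table.smul_apply, Table.flip, twist_apply]
  · intro h
    funext z
    have := h (g.1⁻¹ z.2, g.1⁻¹ z.1)
    simp only [twist_apply] at this
    rw [← mul_apply, ← mul_apply, mul_inv_cancel, one_apply, one_apply] at this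
    exact this.symm

/-- The number of self-dual tables up to renaming. -/
def numTables (a c : ℕ) : ℝ :=
  ∑ j : c.Partition, ∑ k : a.Partition,
    (centralizerOrder j * centralizerOrder k)⁻¹ * twistedProduct j k

/-- The twisted Burnside lemma for transposition, with the sum over permutations grouped by cycle
type; the factorials cancel the order of the group. -/
theorem numClasses_isSelfDual (A C : Type*) [Fintype A] [Fintype C] :
    (numClasses (Table.isoRel A C) Table.IsSelfDual : ℝ) =
      numTables (Fintype.card A) (Fintype.card C) := by
  classical
  have hB := numClasses_mul_card (G := Equiv.Perm A × Equiv.Perm C) (X := Table A C)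
    Table.flip (fun g f => rfl)
  have hfix : ∀ g : Equiv.Perm A × Equiv.Perm C,
      (Nat.card {f : Table A C // g • f.flip = f} : ℝ) =
        twistedProduct g.2.partition g.1.partition := by
    intro g
    rw [← prod_minimalPeriod_twist, Nat.card_congr (Equiv.subtypeEquivRight
      (Table.smul_flip_eq_iff g))]
    refine (card_equivariant (W := Option C) (twist g.1) (Equiv.optionCongr g.2)).trans ?_
    refine Finset.prod_congr rfl fun z _ => ?_
    rw [numFixed_optionCongr_pow _ (minimalPeriod_perm_pos _ _).ne']
  have hcard : (Nat.card (Equiv.Perm A × Equiv.Perm C) : ℝ) =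
      (Fintype.card A).factorial * (Fintype.card C).factorial := by
    rw [Nat.card_prod, Nat.card_perm, Nat.card_perm, Nat.card_eq_fintype_card,
      Nat.card_eq_fintype_card]
    push_cast
    rfl
  rw [finsum_eq_sum_of_fintype] at hB
  have hB' := congrArg (Nat.cast (R := ℝ)) hB
  push_cast at hB'
  rw [hcard, Finset.sum_congr rfl fun g _ => hfix g, Fintype.sum_prod_type_right,
    Finset.sum_congr rfl fun π _ => sum_perm_eq_sum_partition
      fun k => twistedProduct (Equiv.Perm.partition π) k,
    sum_perm_eq_sum_partition fun j => ((Fintype.card A).factorial : ℝ) *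
      ∑ k, (centralizerOrder k)⁻¹ * twistedProduct j k] at hB'
  have h1 : ((Fintype.card A).factorial : ℝ) * (Fintype.card C).factorial ≠ 0 := by
    exact_mod_cast mul_ne_zero (Nat.factorial_ne_zero _) (Nat.factorial_ne_zero _)
  refine mul_right_cancel₀ h1 (Eq.trans hB' ?_)
  rw [numTables, Finset.mul_sum, Finset.sum_mul]
  refine Finset.sum_congr rfl fun j _ => ?_
  rw [Finset.mul_sum, Finset.mul_sum, Finset.mul_sum, Finset.sum_mul]
  refine Finset.sum_congr rfl fun k _ => ?_
  rw [mul_inv]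
  ring

/-- `N` cancels, so only the twisted sum in `L` needs a combinatorial meaning. -/
theorem two_mul_L_sub_N (p q : ℕ) : 2 * L p q - N p q = numTables (p - q) (q - 1) := by
  have : L p q = 1 / 2 * N p q + 1 / 2 * numTables (p - q) (q - 1) := rfl
  rw [this]
  ring

end Nilpotent3
end

noncomputable section

namespace Nilpotent3

/-! ### Tables in which every non-zero element occurs -/

/-- Every element of `C` is an entry of the table. -/
def Table.IsFull {A C : Type*} (f : Table A C) : Prop := ∀ c, ∃ x y, f (x, y) = some c

theorem Table.IsFull.flip {A C : Type*} {f : Table A C} (h : f.IsFull) : f.flip.IsFull := by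
  intro c
  obtain ⟨x, y, hxy⟩ := h c
  exact ⟨y, x, hxy⟩

theorem Table.IsFull.of_isoRel {A C : Type*} {f f' : Table A C} (h : f'.IsFull)
    (hff' : Table.isoRel A C f f') : f.IsFull := by
  obtain ⟨σ, π, hσ⟩ := (Table.isoRel_iff _ _).1 hff'
  intro c
  obtain ⟨x, y, hxy⟩ := h (π.symm c)
  exact ⟨σ x, σ y, by rw [hσ, hxy]; simp⟩

theorem Table.IsSelfDual.of_isoRel {A C : Type*} {f f' : Table A C} (h : f'.IsSelfDual)
    (hff' : Table.isoRel A C f f') : f.IsSelfDual := by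
  have h1 : Table.isoRel A C f.flip f'.flip := by
    obtain ⟨g, rfl⟩ := hff'
    exact ⟨g, rfl⟩
  exact (Table.isoRel A C).trans h1 ((Table.isoRel A C).trans h ((Table.isoRel A C).symm hff'))

/-- Adjoin an element to `C` that does not occur in the table. -/
def Table.extend {A C : Type*} (f : Table A C) : Table A (Option C) := fun z => (f z).map some

/-- The permutation `π` may move the adjoined point, but it sends entries of one table to entries of
the other, and there `Equiv.removeNone` agrees with it. -/
theorem Table.isoRel_extend_iff {A C : Type*} (f f' : Table A C) :
    Table.isoRel A (Option C) f.extend f'.extend ↔ Table.isoRel A C f f' := by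
  rw [Table.isoRel_iff, Table.isoRel_iff]
  constructor
  · rintro ⟨σ, π, h⟩
    refine ⟨σ, Equiv.removeNone π, fun x y => ?_⟩
    have hxy := h x y
    simp only [Table.extend, Option.map_map] at hxy
    cases h1 : f' (x, y) with
    | none => simpa [h1] using hxy
    | some c =>
      simp only [h1, Option.map_some, Option.map_eq_some_iff, Function.comp_apply] at hxy ⊢
      obtain ⟨c', hc', hπ⟩ := hxy
      rw [hc', ← Option.some_inj.1 ((Equiv.removeNone_some π ⟨c', hπ.symm⟩).trans hπ.symm)]
  · rintro ⟨σ, π, h⟩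
    refine ⟨σ, Equiv.optionCongr π, fun x y => ?_⟩
    simp only [Table.extend, h, Option.map_map]
    rfl

theorem Table.isSelfDual_extend_iff {A C : Type*} (f : Table A C) :
    f.extend.IsSelfDual ↔ f.IsSelfDual :=
  Table.isoRel_extend_iff f.flip f

theorem numClasses_not_isFull (A C : Type*) :
    numClasses (Table.isoRel A (Option C)) (fun f => f.IsSelfDual ∧ ¬ f.IsFull) =
      numClasses (Table.isoRel A C) Table.IsSelfDual := by
  classical
  symm
  refine numClasses_congr_of_map Table.extend (fun f hf => ⟨?_, fun h => ?_⟩)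
    (fun f f' _ _ => (Table.isoRel_extend_iff f f').symm) ?_
  · exact (Table.isSelfDual_extend_iff f).2 hf
  · obtain ⟨x, y, hxy⟩ := h none
    simp [Table.extend] at hxy
  · rintro f ⟨hf, hfull⟩
    obtain ⟨c₀, hc₀⟩ := not_forall.1 hfull
    -- Exchanging the missing element `c₀` with `none` makes the adjoined point the missing one, so
    -- `join` only strips a `some` from non-zero entries.
    let f₁ : Table A C := fun z =>
      (((1, Equiv.swap c₀ none) : Equiv.Perm A × Equiv.Perm (Option C)) • f) z |>.join
    have h1 : f₁.extend = ((1, Equiv.swap c₀ none) : Equiv.Perm A × Equiv.Perm (Option C)) • f := by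
      funext z
      simp only [f₁, Table.extend, Table.smul_apply, inv_one, Equiv.Perm.one_apply, Prod.mk.eta]
      cases h2 : f z with
      | none => rfl
      | some c =>
        have hc : c ≠ c₀ := by
          rintro rfl
          exact hc₀ ⟨z.1, z.2, h2⟩
        have h3 : Equiv.swap c₀ none c ≠ none := by
          intro h
          rw [Equiv.swap_apply_eq_iff, Equiv.swap_apply_right] at h
          exact hc h
        cases h4 : Equiv.swap c₀ none c with
        | none => exact absurd h4 h3
        | some c' => simp [h4]
    have h2 : Table.isoRel A (Option C) f₁.extend f := ⟨_, h1.symm⟩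
    exact ⟨f₁, (Table.isSelfDual_extend_iff f₁).1 (hf.of_isoRel h2), h2⟩

theorem numClasses_isFull (A C : Type*) [Fintype A] [Fintype C] :
    (numClasses (Table.isoRel A (Option C)) (fun f => f.IsSelfDual ∧ f.IsFull) : ℝ) =
      numTables (Fintype.card A) (Fintype.card C + 1) -
        numTables (Fintype.card A) (Fintype.card C) := by
  have h := numClasses_eq_add (Table.isoRel A (Option C)) Table.IsSelfDual Table.IsFull
    (fun f f' h => ⟨fun hf => hf.of_isoRel ((Table.isoRel A (Option C)).symm h),
      fun hf => hf.of_isoRel h⟩)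
  rw [numClasses_not_isFull] at h
  have h' := congrArg (Nat.cast (R := ℝ)) h
  push_cast at h'
  rw [numClasses_isSelfDual, numClasses_isSelfDual, Fintype.card_option] at h'
  linarith

theorem Table.IsFull.card_le {A C : Type*} [Fintype A] [Fintype C] {f : Table A C}
    (hf : f.IsFull) : Fintype.card C ≤ Fintype.card A ^ 2 := by
  choose x y hxy using hf
  rw [sq, ← Fintype.card_prod]
  refine Fintype.card_le_of_injective (fun c => (x c, y c)) fun c c' h => ?_
  have h1 := hxy c
  simp only [Prod.mk.injEq] at h
  rw [h.1, h.2, hxy c'] at h1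
  exact (Option.some_inj.1 h1).symm

end Nilpotent3
end

noncomputable section

namespace Nilpotent3

/-! ### Nilpotent semigroups of degree three -/

theorem productSet_one (S : Type*) [Semigroup S] : productSet S 1 = Set.univ := by
  ext x
  simp only [Set.mem_univ, iff_true]
  exact ⟨x, [], rfl, rfl⟩

theorem mem_productSet_two {S : Type*} [Semigroup S] {x : S} :
    x ∈ productSet S 2 ↔ ∃ a b : S, a * b = x := by
  constructor
  · rintro ⟨a, l, hl, rfl⟩
    obtain ⟨b, rfl⟩ := List.length_eq_one_iff.1 (by omega : l.length = 1)
    exact ⟨a, b, rfl⟩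
  · rintro ⟨a, b, rfl⟩
    exact ⟨a, [b], rfl, rfl⟩

theorem mem_productSet_three {S : Type*} [Semigroup S] {x : S} :
    x ∈ productSet S 3 ↔ ∃ a b c : S, a * b * c = x := by
  constructor
  · rintro ⟨a, l, hl, rfl⟩
    obtain ⟨b, c, rfl⟩ := List.length_eq_two.1 (by omega : l.length = 2)
    exact ⟨a, b, c, rfl⟩
  · rintro ⟨a, b, c, rfl⟩
    exact ⟨a, [b, c], rfl, rfl⟩

theorem hasNilpotencyDegree_three_iff (S : Type*) [Semigroup S] :
    HasNilpotencyDegree S 3 ↔ ∃ z : S, (∀ a b c : S, a * b * c = z) ∧ ∃ a b : S, a * b ≠ z := by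
  constructor
  · rintro ⟨⟨-, h⟩, hmin⟩
    obtain ⟨z, hz⟩ := Set.encard_eq_one.1 h
    have h3 : ∀ a b c : S, a * b * c = z := fun a b c => by
      have : a * b * c ∈ productSet S 3 := mem_productSet_three.2 ⟨a, b, c, rfl⟩
      rwa [hz] at this
    refine ⟨z, h3, ?_⟩
    by_contra! hcon
    have h2 : productSet S 2 = {z} := by
      ext x
      rw [mem_productSet_two, Set.mem_singleton_iff]
      exact ⟨fun ⟨a, b, hab⟩ => hab ▸ hcon a b, fun hx => ⟨z, z, by rw [hx, hcon]⟩⟩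
    have := hmin ⟨one_le_two, by rw [h2, Set.encard_singleton]⟩
    omega
  · rintro ⟨z, h3, a, b, hab⟩
    have hz2 : z ∈ productSet S 2 := mem_productSet_two.2 ⟨z * z, z, h3 z z z⟩
    refine ⟨⟨by norm_num, Set.encard_eq_one.2 ⟨z, ?_⟩⟩, ?_⟩
    · ext x
      rw [mem_productSet_three, Set.mem_singleton_iff]
      exact ⟨fun ⟨a, b, c, h⟩ => h ▸ h3 a b c, fun hx => ⟨z, z, z, by rw [hx, h3]⟩⟩
    · rintro k ⟨hk, hk1⟩
      by_contra hlt
      obtain ⟨w, hw⟩ := Set.encard_eq_one.1 hk1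
      have hmem : a * b ∈ productSet S k ∧ z ∈ productSet S k := by
        obtain rfl | rfl : k = 1 ∨ k = 2 := by omega
        · rw [productSet_one]
          exact ⟨trivial, trivial⟩
        · exact ⟨mem_productSet_two.2 ⟨a, b, rfl⟩, hz2⟩
      rw [hw] at hmem
      exact hab (hmem.1.trans hmem.2.symm)

theorem isSelfDual_iff (S : Type*) [Semigroup S] :
    IsSelfDual S ↔ ∃ E : S ≃ S, ∀ a b, E (a * b) = E b * E a := by
  constructor
  · rintro ⟨e⟩
    refine ⟨e.toEquiv.trans MulOpposite.opEquiv.symm, fun a b => ?_⟩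
    simp
  · rintro ⟨E, hE⟩
    exact ⟨⟨E.trans MulOpposite.opEquiv, fun a b => by simp [hE]⟩⟩

theorem ncard_productSet_two_eq_of_mulEquiv {S T : Type*} [Semigroup S] [Semigroup T]
    (e : S ≃* T) : (productSet S 2).ncard = (productSet T 2).ncard := by
  rw [← Set.ncard_image_of_injective _ e.injective]
  congr 1
  ext x
  simp only [Set.mem_image, mem_productSet_two]
  constructor
  · rintro ⟨_, ⟨a, b, rfl⟩, rfl⟩
    exact ⟨e a, e b, (map_mul e a b).symm⟩
  · rintro ⟨a, b, rfl⟩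
    exact ⟨_, ⟨e.symm a, e.symm b, rfl⟩, by simp⟩

theorem two_le_ncard_productSet_two {S : Type*} [Semigroup S] [Finite S]
    (h : HasNilpotencyDegree S 3) : 2 ≤ (productSet S 2).ncard := by
  obtain ⟨z, h3, a, b, hab⟩ := (hasNilpotencyDegree_three_iff S).1 h
  refine (Set.ncard_pair hab).symm.le.trans (Set.ncard_le_ncard ?_)
  rintro x (rfl | rfl)
  · exact mem_productSet_two.2 ⟨a, b, rfl⟩
  · exact mem_productSet_two.2 ⟨x * x, x, h3 x x x⟩

/-! ### The semigroup of a table -/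

/-- The multiplication on `A ⊕ (C ∪ {0})` defined by a table, all products other than those of
two elements of `A` being zero. -/
def Table.mul {A C : Type*} (f : Table A C) : A ⊕ Option C → A ⊕ Option C → A ⊕ Option C
  | .inl x, .inl y => .inr (f (x, y))
  | _, _ => .inr none

theorem Table.mul_inl_inl {A C : Type*} (f : Table A C) (x y : A) :
    f.mul (.inl x) (.inl y) = .inr (f (x, y)) := rfl

theorem Table.mul_inr_left {A C : Type*} (f : Table A C) (w : Option C) (v : A ⊕ Option C) :
    f.mul (.inr w) v = .inr none := by
  cases v <;> rfl

theorem Table.mul_inr_right {A C : Type*} (f : Table A C) (u : A ⊕ Option C) (w : Option C) :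
    f.mul u (.inr w) = .inr none := by
  cases u <;> rfl

theorem Table.exists_mul_eq_inr {A C : Type*} (f : Table A C) (u v : A ⊕ Option C) :
    ∃ w, f.mul u v = .inr w := by
  rcases u with x | w
  · rcases v with y | w
    · exact ⟨_, rfl⟩
    · exact ⟨_, rfl⟩
  · exact ⟨_, f.mul_inr_left w v⟩

theorem Table.flip_mul {A C : Type*} (f : Table A C) (u v : A ⊕ Option C) :
    f.flip.mul u v = f.mul v u := by
  cases u <;> cases v <;> rfl

theorem Table.IsFull.exists_mul_eq {A C : Type*} {f : Table A C} (hf : f.IsFull)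
    (w : Option C) : ∃ u v, f.mul u v = .inr w := by
  cases w with
  | none => exact ⟨.inr none, .inr none, rfl⟩
  | some c =>
    obtain ⟨x, y, h⟩ := hf c
    exact ⟨.inl x, .inl y, by rw [Table.mul_inl_inl, h]⟩

/-- The semigroup defined by a table, transported along a bijection. -/
@[reducible] def Table.toSemigroup {A C X : Type*} (e : A ⊕ Option C ≃ X) (f : Table A C) :
    Semigroup X where
  mul a b := e (f.mul (e.symm a) (e.symm b))
  mul_assoc a b c := by
    change e (f.mul (e.symm (e _)) _) = e (f.mul _ (e.symm (e _)))
    rw [Equiv.symm_apply_apply, Equiv.symm_apply_apply]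
    obtain ⟨w, hw⟩ := f.exists_mul_eq_inr (e.symm a) (e.symm b)
    obtain ⟨w', hw'⟩ := f.exists_mul_eq_inr (e.symm b) (e.symm c)
    rw [hw, hw', Table.mul_inr_left, Table.mul_inr_right]

theorem Table.toSemigroup_mul {A C X : Type*} (e : A ⊕ Option C ≃ X) (f : Table A C)
    (a b : X) : (f.toSemigroup e).mul a b = e (f.mul (e.symm a) (e.symm b)) := rfl

theorem Table.exists_equiv_of_isoRel {A C : Type*} {f f' : Table A C}
    (h : Table.isoRel A C f' f) :
    ∃ E : A ⊕ Option C ≃ A ⊕ Option C, ∀ u v, E (f.mul u v) = f'.mul (E u) (E v) := by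
  obtain ⟨σ, π, h⟩ := (Table.isoRel_iff _ _).1 h
  refine ⟨σ.sumCongr (Equiv.optionCongr π), fun u v => ?_⟩
  rcases u with x | w
  · rcases v with y | w
    · simp [Table.mul_inl_inl, h]
    · simp [Table.mul_inr_right]
  · simp [Table.mul_inr_left]

/-- Fullness makes the right summand the set of all products, so `E` maps it into itself, and by
finiteness onto itself; hence `E` also preserves the left summand. It fixes zero because zero is its
own square. -/
theorem Table.isoRel_of_equiv {A C : Type*} [Finite A] [Finite C] {f f' : Table A C}
    (hf : f.IsFull) (E : A ⊕ Option C ≃ A ⊕ Option C)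
    (hE : ∀ u v, E (f.mul u v) = f'.mul (E u) (E v)) : Table.isoRel A C f' f := by
  have h1 : ∀ w, ∃ w', E (.inr w) = .inr w' := by
    intro w
    obtain ⟨u, v, huv⟩ := hf.exists_mul_eq w
    rw [← huv, hE]
    exact f'.exists_mul_eq_inr _ _
  choose τ hτ using h1
  have hτi : Function.Injective τ := fun w w' h => by
    have : E (.inr w) = E (.inr w') := by rw [hτ, hτ, h]
    exact Sum.inr_injective (E.injective this)
  have hτb : Function.Bijective τ := Finite.injective_iff_bijective.1 hτi
  have h2 : ∀ x, ∃ x', E (.inl x) = .inl x' := by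
    intro x
    cases h : E (.inl x) with
    | inl x' => exact ⟨x', rfl⟩
    | inr w =>
      obtain ⟨w', rfl⟩ := hτb.2 w
      rw [← hτ, EmbeddingLike.apply_eq_iff_eq] at h
      cases h
  choose σ hσ using h2
  have hσi : Function.Injective σ := fun x x' h => by
    have : E (.inl x) = E (.inl x') := by rw [hσ, hσ, h]
    exact Sum.inl_injective (E.injective this)
  have hσb : Function.Bijective σ := Finite.injective_iff_bijective.1 hσi
  have hnone : τ none = none := by
    have h := hE (.inr none) (.inr none)
    rw [hτ, Table.mul_inr_left, Table.mul_inr_left, hτ] at h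
    exact Sum.inr_injective h
  rw [Table.isoRel_iff]
  refine ⟨Equiv.ofBijective σ hσb, Equiv.removeNone (Equiv.ofBijective τ hτb), fun x y => ?_⟩
  have h := hE (.inl x) (.inl y)
  rw [hσ, hσ, Table.mul_inl_inl, Table.mul_inl_inl, hτ] at h
  change f' (σ x, σ y) = _
  rw [← Sum.inr_injective h]
  cases h3 : f (x, y) with
  | none => exact hnone
  | some c =>
    have h4 : ∃ c', Equiv.ofBijective τ hτb (some c) = some c' := by
      cases h5 : τ (some c) with
      | none => exact absurd (hτi (h5.trans hnone.symm)) (by simp)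
      | some c' => exact ⟨c', h5⟩
    exact (Equiv.removeNone_some _ h4).symm

/-! ### Isomorphism, duality and nilpotency carried over to semigroups on `Fin n`. -/

theorem isoSetoid_iff {n : ℕ} (S T : Semigroup (Fin n)) :
    isoSetoid n S T ↔ ∃ E : Fin n ≃ Fin n, ∀ a b, E (S.mul a b) = T.mul (E a) (E b) :=
  ⟨fun ⟨e⟩ => ⟨@MulEquiv.toEquiv (Fin n) (Fin n) S.toMul T.toMul e,
    @MulEquiv.map_mul' (Fin n) (Fin n) S.toMul T.toMul e⟩,
    fun ⟨E, hE⟩ => ⟨@MulEquiv.mk (Fin n) (Fin n) S.toMul T.toMul E hE⟩⟩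

theorem isoSetoid_toSemigroup_iff {A C : Type*} [Finite A] [Finite C] {n : ℕ}
    (e : A ⊕ Option C ≃ Fin n) {f f' : Table A C} (hf : f.IsFull) :
    isoSetoid n (f.toSemigroup e) (f'.toSemigroup e) ↔ Table.isoRel A C f' f := by
  rw [isoSetoid_iff]
  constructor
  · rintro ⟨E, hE⟩
    refine Table.isoRel_of_equiv hf ((e.trans E).trans e.symm) fun u v => ?_
    have := hE (e u) (e v)
    simp only [Table.toSemigroup_mul, Equiv.symm_apply_apply] at this
    simp [this]
  · intro h
    obtain ⟨E, hE⟩ := Table.exists_equiv_of_isoRel h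
    refine ⟨(e.symm.trans E).trans e, fun a b => ?_⟩
    simp [Table.toSemigroup_mul, hE]

theorem isSelfDual_toSemigroup_iff {A C : Type*} [Finite A] [Finite C] {n : ℕ}
    (e : A ⊕ Option C ≃ Fin n) {f : Table A C} (hf : f.IsFull) :
    @IsSelfDual (Fin n) (f.toSemigroup e) ↔ f.IsSelfDual := by
  have h1 : @IsSelfDual (Fin n) (f.toSemigroup e) ↔
      isoSetoid n (f.toSemigroup e) (f.flip.toSemigroup e) := by
    rw [@isSelfDual_iff (Fin n) (f.toSemigroup e), isoSetoid_iff]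
    refine exists_congr fun E => forall_congr' fun a => forall_congr' fun b => ?_
    rw [Table.toSemigroup_mul e f.flip, Table.flip_mul]
    rfl
  rw [h1, isoSetoid_toSemigroup_iff e hf]
  rfl

theorem IsSelfDual.of_isoSetoid {n : ℕ} {S T : Semigroup (Fin n)} (h : isoSetoid n S T)
    (hT : @IsSelfDual (Fin n) T) : @IsSelfDual (Fin n) S := by
  obtain ⟨E, hE⟩ := (isoSetoid_iff S T).1 h
  obtain ⟨D, hD⟩ := (@isSelfDual_iff (Fin n) T).1 hT
  refine (@isSelfDual_iff (Fin n) S).2 ⟨(E.trans D).trans E.symm, fun a b => ?_⟩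
  change E.symm (D (E (S.mul a b))) = S.mul (E.symm (D (E b))) (E.symm (D (E a)))
  rw [Equiv.symm_apply_eq, hE, hE, Equiv.apply_symm_apply, Equiv.apply_symm_apply]
  exact hD _ _

theorem hasNilpotencyDegree_toSemigroup {A C X : Type*} [Nonempty C] (e : A ⊕ Option C ≃ X)
    {f : Table A C} (hf : f.IsFull) : @HasNilpotencyDegree X (f.toSemigroup e) 3 := by
  rw [@hasNilpotencyDegree_three_iff X (f.toSemigroup e)]
  refine ⟨e (.inr none), fun a b c => ?_, ?_⟩
  · change e (f.mul (e.symm (e _)) _) = _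
    obtain ⟨w, hw⟩ := f.exists_mul_eq_inr (e.symm a) (e.symm b)
    rw [Equiv.symm_apply_apply, hw, Table.mul_inr_left]
  · obtain ⟨c⟩ := ‹Nonempty C›
    obtain ⟨u, v, huv⟩ := hf.exists_mul_eq (some c)
    refine ⟨e u, e v, ?_⟩
    change e (f.mul (e.symm (e _)) (e.symm (e _))) ≠ _
    rw [Equiv.symm_apply_apply, Equiv.symm_apply_apply, huv]
    simp

theorem ncard_productSet_toSemigroup {A C X : Type*} [Fintype C] (e : A ⊕ Option C ≃ X)
    {f : Table A C} (hf : f.IsFull) :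
    (@productSet X (f.toSemigroup e) 2).ncard = Fintype.card C + 1 := by
  have h : @productSet X (f.toSemigroup e) 2 = Set.range fun w => e (.inr w) := by
    ext x
    rw [@mem_productSet_two X (f.toSemigroup e)]
    constructor
    · rintro ⟨a, b, rfl⟩
      obtain ⟨w, hw⟩ := f.exists_mul_eq_inr (e.symm a) (e.symm b)
      exact ⟨w, congrArg e hw.symm⟩
    · rintro ⟨w, rfl⟩
      obtain ⟨u, v, huv⟩ := hf.exists_mul_eq w
      refine ⟨e u, e v, ?_⟩
      change e (f.mul (e.symm (e _)) (e.symm (e _))) = _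
      rw [Equiv.symm_apply_apply, Equiv.symm_apply_apply, huv]
  have hinj : Function.Injective fun w : Option C => e (.inr w) :=
    e.injective.comp Sum.inr_injective
  rw [h, ← Set.image_univ, Set.ncard_image_of_injective _ hinj, Set.ncard_univ, Nat.card_eq_fintype_card, Fintype.card_option]

/-- A bijection from `A ⊕ (C ∪ {0})` that sends `C ∪ {0}` to a given set and `0` to a given
element of it. -/
theorem exists_equiv_sum_option {A C X : Type*} [Finite A] [Finite C] [Finite X] (B : Set X)
    {z : X} (hz : z ∈ B) (hC : Nat.card C + 1 = B.ncard)
    (hA : Nat.card A + B.ncard = Nat.card X) :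
    ∃ E : A ⊕ Option C ≃ X, (∀ w, E (.inr w) ∈ B) ∧ (∀ x, E (.inl x) ∉ B) ∧
      E (.inr none) = z := by
  classical
  have h1 : Nat.card (Option C) = Nat.card B := by
    rw [Finite.card_option, hC, Nat.card_coe_set_eq]
  have h2 : Nat.card A = Nat.card {x // ¬ x ∈ B} := by
    have h3 := Nat.card_congr (Equiv.sumCompl (· ∈ B))
    rw [Nat.card_sum] at h3
    have h4 : Nat.card {x // x ∈ B} = B.ncard := Nat.card_coe_set_eq B
    omega
  obtain ⟨ε⟩ := Finite.card_eq.1 h1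
  obtain ⟨δ⟩ := Finite.card_eq.1 h2
  -- The swap corrects an arbitrary bijection so that `none` goes to `z`.
  let ε' : Option C ≃ {x // x ∈ B} := ε.trans (Equiv.swap (ε none) ⟨z, hz⟩)
  refine ⟨((Equiv.sumCongr δ ε').trans (Equiv.sumComm _ _)).trans (Equiv.sumCompl (· ∈ B)),
    fun w => ?_, fun x => ?_, ?_⟩
  · simp
  · simpa using (δ x).2
  · simp [ε']

/-- Labelling the products by C ∪ {0}, with `none` for the zero, presents `S` as a table: every
product involving a product is a triple product and so vanishes. -/
theorem exists_table {A C : Type*} [Finite A] [Finite C] {n : ℕ} (e : A ⊕ Option C ≃ Fin n)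
    (S : Semigroup (Fin n)) (hS : @HasNilpotencyDegree (Fin n) S 3)
    (hcard : (@productSet (Fin n) S 2).ncard = Nat.card C + 1) :
    ∃ f : Table A C, f.IsFull ∧ isoSetoid n (f.toSemigroup e) S := by
  obtain ⟨z, h3, -⟩ := (@hasNilpotencyDegree_three_iff (Fin n) S).1 hS
  have hz : z ∈ @productSet (Fin n) S 2 :=
    (@mem_productSet_two (Fin n) S z).2 ⟨S.mul z z, z, h3 z z z⟩
  have hA : Nat.card A + (@productSet (Fin n) S 2).ncard = Nat.card (Fin n) := by
    rw [hcard, ← Finite.card_option, ← Nat.card_sum, Nat.card_congr e]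
  obtain ⟨E, hEr, hEl, hEz⟩ := exists_equiv_sum_option _ hz hcard.symm hA
  have hprod : ∀ a b, ∃ w, E (.inr w) = S.mul a b := by
    intro a b
    have hab : S.mul a b ∈ @productSet (Fin n) S 2 :=
      (@mem_productSet_two (Fin n) S _).2 ⟨a, b, rfl⟩
    cases h : E.symm (S.mul a b) with
    | inl x =>
      rw [Equiv.symm_apply_eq] at h
      exact absurd (h ▸ hab) (hEl x)
    | inr w => exact ⟨w, ((Equiv.symm_apply_eq _).1 h).symm⟩
  have hleft : ∀ w b, S.mul (E (.inr w)) b = z := by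
    intro w b
    obtain ⟨a, a', h⟩ := (@mem_productSet_two (Fin n) S _).1 (hEr w)
    rw [← h]
    exact h3 a a' b
  have hright : ∀ a w, S.mul a (E (.inr w)) = z := by
    intro a w
    obtain ⟨b, b', h⟩ := (@mem_productSet_two (Fin n) S _).1 (hEr w)
    rw [← h]
    exact (S.mul_assoc a b b').symm.trans (h3 a b b')
  choose p hp using hprod
  let f : Table A C := fun w => p (E (.inl w.1)) (E (.inl w.2))
  have hE : ∀ u v, E (f.mul u v) = S.mul (E u) (E v) := by
    intro u v
    rcases u with x | w
    · rcases v with y | w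
      · exact hp _ _
      · rw [Table.mul_inr_right, hEz, hright]
    · rw [Table.mul_inr_left, hEz, hleft]
  refine ⟨f, fun c => ?_, (isoSetoid_iff _ _).2 ⟨e.symm.trans E, fun a b => ?_⟩⟩
  · obtain ⟨a, b, hab⟩ := (@mem_productSet_two (Fin n) S _).1 (hEr (some c))
    obtain ⟨u, rfl⟩ := E.surjective a
    obtain ⟨v, rfl⟩ := E.surjective b
    have h : f.mul u v = .inr (some c) := E.injective ((hE u v).trans hab)
    rcases u with x | w
    · rcases v with y | w
      · exact ⟨x, y, Sum.inr_injective h⟩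
      · rw [Table.mul_inr_right] at h
        simp at h
    · rw [Table.mul_inr_left] at h
      simp at h
  · simp [Table.toSemigroup_mul, hE]

/-- Self-dual nilpotent semigroups of degree three with a given number of products, up to
isomorphism, correspond to tables. -/
theorem numClasses_semigroup_eq {A C : Type*} [Fintype A] [Fintype C] [Nonempty C] {n m : ℕ}
    (hm : Fintype.card C + 1 = m) (hn : Fintype.card A + m = n) :
    numClasses (isoSetoid n) (fun S => (@HasNilpotencyDegree (Fin n) S 3 ∧
        @IsSelfDual (Fin n) S) ∧ (@productSet (Fin n) S 2).ncard = m) =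
      numClasses (Table.isoRel A C) (fun f => f.IsSelfDual ∧ f.IsFull) := by
  have e : A ⊕ Option C ≃ Fin n := Fintype.equivFinOfCardEq (by simp; omega)
  symm
  refine numClasses_congr_of_map (Table.toSemigroup e) ?_ ?_ ?_
  · rintro f ⟨hf, hfull⟩
    exact ⟨⟨hasNilpotencyDegree_toSemigroup e hfull, (isSelfDual_toSemigroup_iff e hfull).2 hf⟩,
      (ncard_productSet_toSemigroup e hfull).trans hm⟩
  · rintro f f' ⟨-, hf⟩ -
    rw [isoSetoid_toSemigroup_iff e hf]
    exact ⟨(Table.isoRel A C).symm, (Table.isoRel A C).symm⟩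
  · rintro S ⟨⟨hS, hdual⟩, hcard⟩
    obtain ⟨f, hf, hiso⟩ := exists_table e S hS
      (by rw [hcard, ← hm, Nat.card_eq_fintype_card])
    exact ⟨f, ⟨(isSelfDual_toSemigroup_iff e hf).1 (IsSelfDual.of_isoSetoid hiso hdual), hf⟩, hiso⟩

instance (n : ℕ) : Finite (Semigroup (Fin n)) := by
  refine Finite.of_injective (fun S : Semigroup (Fin n) => S.mul) fun S T h => ?_
  exact Semigroup.ext h

/-! ### The formula -/

theorem upperIndex_le (n : ℕ) : upperIndex n ≤ n := by
  refine Nat.lt_succ_iff.1 (Nat.floor_lt' (Nat.succ_ne_zero n) |>.2 ?_)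
  have := Real.sqrt_nonneg ((n : ℝ) - 3 / 4)
  push_cast
  linarith

/-- Exceeding the floor means n − m + 1/2 < √(n − 3/4); squaring and cancelling gives (n − m)² + 1 <
m. -/
theorem sq_lt_of_upperIndex_lt {n m : ℕ} (hmn : m ≤ n) (h : upperIndex n < m) :
    (n - m) ^ 2 < m - 1 := by
  have h1 := Nat.lt_of_floor_lt h
  have hle : (m : ℝ) ≤ n := by exact_mod_cast hmn
  have h2 : ((n : ℝ) - m) + 1 / 2 < √((n : ℝ) - 3 / 4) := by linarith
  have h3 := (Real.lt_sqrt (by linarith)).1 h2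
  have h4 : ((n : ℝ) - m) ^ 2 + 1 < m := by nlinarith
  rw [← Nat.cast_sub hmn] at h4
  have h5 : (n - m) ^ 2 + 1 < m := by exact_mod_cast h4
  omega

theorem numSelfDualNilpotent3_eq (n : ℕ) :
    (numSelfDualNilpotent3 n : ℝ) = ∑ m ∈ Finset.Icc 2 (upperIndex n),
      (2 * L n m - N n m - 2 * L (n - 1) (m - 1) + N (n - 1) (m - 1)) := by
  have h1 : numSelfDualNilpotent3 n = ∑ m ∈ Finset.Icc 2 n,
      numClasses (isoSetoid n) (fun S => (@HasNilpotencyDegree (Fin n) S 3 ∧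
        @IsSelfDual (Fin n) S) ∧ (@productSet (Fin n) S 2).ncard = m) := by
    refine numClasses_eq_sum (isoSetoid n) _ (fun S => (@productSet (Fin n) S 2).ncard) _ ?_ ?_
    · rintro S T ⟨e⟩
      exact @ncard_productSet_two_eq_of_mulEquiv (Fin n) (Fin n) S T e
    · rintro S ⟨hS, -⟩
      refine Finset.mem_Icc.2 ⟨@two_le_ncard_productSet_two (Fin n) S _ hS, ?_⟩
      simpa using Set.ncard_le_card (@productSet (Fin n) S 2)
  have h2 : ∀ m ∈ Finset.Icc 2 n,
      numClasses (isoSetoid n) (fun S => (@HasNilpotencyDegree (Fin n) S 3 ∧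
        @IsSelfDual (Fin n) S) ∧ (@productSet (Fin n) S 2).ncard = m) =
      -- Since m ≥ 2, the non-zero products number m − 1 ≥ 1; writing this set as an `Option`
      -- prepares the removal of one element.
      numClasses (Table.isoRel (Fin (n - m)) (Option (Fin (m - 2))))
        (fun f => f.IsSelfDual ∧ f.IsFull) := by
    intro m hm
    rw [Finset.mem_Icc] at hm
    exact numClasses_semigroup_eq (by simp; omega) (by simp; omega)
  rw [h1, Finset.sum_congr rfl h2, ← Finset.sum_subset
    (Finset.Icc_subset_Icc_right (upperIndex_le n)), Nat.cast_sum]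
  · refine Finset.sum_congr rfl fun m hm => ?_
    have hm2 := (Finset.mem_Icc.1 hm).1
    have hL := two_mul_L_sub_N n m
    have hL' := two_mul_L_sub_N (n - 1) (m - 1)
    rw [show n - 1 - (m - 1) = n - m by omega, show m - 1 - 1 = m - 2 by omega] at hL'
    rw [numClasses_isFull, Fintype.card_fin, Fintype.card_fin, show m - 2 + 1 = m - 1 by omega]
    linarith
  -- Beyond the upper index no table is full, since it has too few cells for m − 1 values.
  · intro m hm hm'
    rw [Finset.mem_Icc] at hm hm'
    refine numClasses_eq_zero ?_
    rintro f ⟨-, hf⟩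
    have hle := hf.card_le
    have hlt := sq_lt_of_upperIndex_lt hm.2 (by omega : upperIndex n < m)
    rw [Fintype.card_option, Fintype.card_fin, Fintype.card_fin] at hle
    omega

end Nilpotent3

end

theorem corollary2p4 (n : ℕ) (hn : 1 ≤ n) :
    (Nilpotent3.numSelfDualNilpotent3 n : ℝ) =
      ∑ m ∈ Finset.Icc 2 (Nilpotent3.upperIndex n),
        (2 * Nilpotent3.L n m - Nilpotent3.N n m
          - 2 * Nilpotent3.L (n - 1) (m - 1) + Nilpotent3.N (n - 1) (m - 1)) := by
  exact Nilpotent3.numSelfDualNilpotent3_eq n
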